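/- Let $X_1,\dots,X_r$ be locally compact Hadamard spaces (complete geodesic metric spaces whose geodesic triangles all satisfy the CAT(0) inequality), and let $X=X_1\times\dots\times X_r$ carry the distance $d=\sqrt{d_1^2+\dots+d_r^2}$. Let $\partial X$ and $\partial X_i$ be the geometric boundaries (asymptote classes of geodesic rays) with the cone topology. Every geodesic ray $\sigma$ of $X$ has the form $\sigma(t)=(\sigma_1(\theta_1t),\dots,\sigma_r(\theta_rt))$ with $\theta_i\ge 0$, $\sum_i\theta_i^2=1$ and geodesic rays $\sigma_i$ of $X_i$ for those $i$ with $\theta_i>0$; its slope $(\theta_1,\dots,\theta_r)$ depends only on the class $\tilde\xi=\sigma(\infty)$ and is denoted $\mathrm{sl}(\tilde\xi)\in E=\{\theta\in\mathbb R^r_{\ge0}:\|\theta\|=1\}$. Let $E^+=E\cap\mathbb R^r_{>0}$, let $\partial X^{reg}=\{\tilde\xi\in\partial X:\mathrm{sl}(\tilde\xi)\in E^+\}$ be the regular boundary, let $\partial^FX=\partial X_1\times\dots\times\partial X_r$, with the product topology, be the Furstenberg boundary, and let $\pi^F:\partial X^{reg}\to\partial^FX$ be the map $\sigma(\infty)\mapsto(\sigma_1(\infty),\dots,\sigma_r(\infty))$.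 An isometry of $X_i$ is of rank one if it translates, by some positive length, a geodesic line that does not bound a flat half-plane; two such isometries $g_i,h_i$ are independent if for every $x\in X_i$ the map $\mathbb Z\times\mathbb Z\to[0,\infty)$, $(m,n)\mapsto d_i(g_i^mx,h_i^nx)$, is proper. Let $\Gamma<\mathrm{Is}(X_1)\times\dots\times\mathrm{Is}(X_r)$ be a group that acts properly discontinuously on $X$ and contains two elements $g=(g_1,\dots,g_r)$ and $h=(h_1,\dots,h_r)$ such that for every $i$ the isometries $g_i$ and $h_i$ of $X_i$ are of rank one and independent. Let $o\in X$ be arbitrary, and let $L_\Gamma=\overline{\Gamma\cdot o}\cap\partial X$ be the geometric limit set (closure in $X\cup\partial X$ with the cone topology), $F_\Gamma=\pi^F(L_\Gamma\cap\partial X^{reg})$ the Furstenberg limit set, $P_\Gamma\subset E$ the set of slopes of the points of $L_\Gamma$, and $P_\Gamma^{reg}=P_\Gamma\cap E^+$ the set of slopes of regular limit points. Then the map $\tilde\xi\mapsto(\pi^F(\tilde\xi),\mathrm{sl}(\tilde\xi))$ is a homeomorphism from the regular geometric limit set $L_\Gamma\cap\partial X^{reg}$ onto the product $F_\Gamma\times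 P_\Gamma^{reg}$. -/

import Mathlib

open scoped NNReal

noncomputable section

namespace HadamardProduct

/-! ### Geodesics and Hadamard spaces -/

section Spaces

variable {X : Type*} [MetricSpace X]

/-- `σ` restricted to `[0, l]` is a geodesic path (parametrized by arc length) of length `l`. -/
def IsGeodesicPath (σ : ℝ → X) (l : ℝ) : Prop :=
  0 ≤ l ∧ ∀ s ∈ Set.Icc 0 l, ∀ t ∈ Set.Icc 0 l, dist (σ s) (σ t) = |s - t|

variable (X) in
/-- Hadamard spaces: complete geodesic metric spaces all of whose geodesic triangles are at most as
thick as their comparison triangles in the Euclidean plane. The two sides of the triangle that carry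
the points to be compared are `σ` and `τ`; they issue from the vertex `σ 0 = τ 0`. -/
structure IsHadamard : Prop where
  complete : CompleteSpace X
  exists_geodesic : ∀ x y : X, ∃ σ : ℝ → X,
    IsGeodesicPath σ (dist x y) ∧ σ 0 = x ∧ σ (dist x y) = y
  cat_zero : ∀ (σ τ : ℝ → X) (l m : ℝ), IsGeodesicPath σ l → IsGeodesicPath τ m → σ 0 = τ 0 →
    ∀ p q r : EuclideanSpace ℝ (Fin 2),
      dist p q = l → dist p r = m → dist q r = dist (σ l) (τ m) →
      ∀ s ∈ Set.Icc (0 : ℝ) 1, ∀ t ∈ Set.Icc (0 : ℝ) 1,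
        dist (σ (s * l)) (τ (t * m)) ≤ dist (AffineMap.lineMap p q s) (AffineMap.lineMap p r t)

/-! ### Geometric boundary and cone topology -/

variable (X) in
/-- Geodesic rays. -/
abbrev GeodesicRay : Type _ := {σ : ℝ≥0 → X // Isometry σ}

variable (X) in
/-- Two rays are asymptotic if they stay at bounded distance from each other. -/
instance asymptotic : Setoid (GeodesicRay X) where
  r σ τ := ∃ C : ℝ, ∀ t, dist (σ.1 t) (τ.1 t) ≤ C
  iseqv :=
    { refl := fun _ => ⟨0, fun _ => (dist_self _).le⟩
      symm := fun ⟨C, h⟩ => ⟨C, fun t => by rw [dist_comm]; exact h t⟩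
      trans := fun ⟨C, h⟩ ⟨D, k⟩ =>
        ⟨C + D, fun t => (dist_triangle _ _ _).trans (add_le_add (h t) (k t))⟩ }

variable (X) in
/-- The geometric boundary `∂X`: asymptote classes of geodesic rays. -/
def Boundary : Type _ := Quotient (asymptotic X)

/-- The boundary point represented by a ray. -/
def GeodesicRay.endpoint (σ : GeodesicRay X) : Boundary X := Quotient.mk _ σ

variable (X) in
/-- The set `X ∪ ∂X`. -/
inductive Bordification : Type _
  | point (x : X) : Bordification
  | ideal (ξ : Boundary X) : Bordification

/-- The truncated cone `U(ρ, R, ε)` around the ray `ρ`: all points at distance greater than `R`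
from `ρ 0` (ideal points included) for which the geodesic path or ray from `ρ 0` to the point passes,
at time `R`, at distance less than `ε` from `ρ R`. -/
def coneNhd (ρ : GeodesicRay X) (R : ℝ≥0) (ε : ℝ) : Set (Bordification X) :=
  {z | match z with
    | .point y => (R : ℝ) < dist (ρ.1 0) y ∧ ∃ σ : ℝ → X,
        IsGeodesicPath σ (dist (ρ.1 0) y) ∧ σ 0 = ρ.1 0 ∧ σ (dist (ρ.1 0) y) = y ∧
          dist (σ R) (ρ.1 R) < ε
    | .ideal η => ∃ τ : GeodesicRay X,
        τ.1 0 = ρ.1 0 ∧ τ.endpoint = η ∧ dist (τ.1 R) (ρ.1 R) < ε}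

/-- The cone topology on `X ∪ ∂X`: it is generated by the open subsets of `X` and the truncated
cones around all geodesic rays. -/
instance : TopologicalSpace (Bordification X) :=
  TopologicalSpace.generateFrom
    ({A | ∃ O : Set X, IsOpen O ∧ A = Bordification.point '' O} ∪
      {A | ∃ (ρ : GeodesicRay X) (R : ℝ≥0) (ε : ℝ), 0 < ε ∧ A = coneNhd ρ R ε})

/-- The cone topology on `∂X`. -/
instance : TopologicalSpace (Boundary X) :=
  TopologicalSpace.induced Bordification.ideal inferInstance

/-! ### Rank one isometries -/

/-- A subset is convex if it contains every geodesic path between any two of its points. -/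
def IsGeodesicallyConvex (A : Set X) : Prop :=
  ∀ (σ : ℝ → X) (l : ℝ), IsGeodesicPath σ l → σ 0 ∈ A → σ l ∈ A → ∀ t ∈ Set.Icc 0 l, σ t ∈ A

/-- The geodesic line `σ` is the boundary line of a closed convex subset isometric to the flat
half-plane `[0, ∞) × ℝ`. -/
def BoundsFlatHalfPlane (σ : ℝ → X) : Prop :=
  ∃ ι : WithLp 2 (ℝ≥0 × ℝ) → X, Isometry ι ∧ IsClosed (Set.range ι) ∧
    IsGeodesicallyConvex (Set.range ι) ∧ ∀ t : ℝ, σ t = ι (WithLp.toLp 2 (0, t))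

/-- `σ` is a geodesic line that `h` translates by some positive length. -/
def IsAxis (h : X ≃ᵢ X) (σ : ℝ → X) : Prop :=
  Isometry σ ∧ ∃ l : ℝ, 0 < l ∧ ∀ t, h (σ t) = σ (t + l)

/-- A rank one isometry: an axial isometry one of whose axes does not bound a flat half-plane. -/
def IsRankOne (h : X ≃ᵢ X) : Prop :=
  ∃ σ : ℝ → X, IsAxis h σ ∧ ¬ BoundsFlatHalfPlane σ

/-- Independence of two (axial) isometries: `(m, n) ↦ d(g ^ m x, h ^ n x)` is a proper map
`ℤ × ℤ → [0, ∞)` for every `x`. -/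
def AreIndependent (g h : X ≃ᵢ X) : Prop :=
  ∀ x : X, IsProperMap fun p : ℤ × ℤ => nndist ((g ^ p.1) x) ((h ^ p.2) x)

end Spaces

/-! ### Products -/

section Products

variable {ι : Type*} [Fintype ι] {X : ι → Type*} [∀ i, MetricSpace (X i)]

/-- The product of the isometry groups acts factorwise on the `ℓ²`-product. -/
instance : MulAction (∀ i, X i ≃ᵢ X i) (PiLp 2 X) where
  smul γ x := WithLp.toLp 2 fun i => γ i (x i)
  one_smul _ := rfl
  mul_smul _ _ _ := rfl

/-- The distance vector `H(x, z)`. -/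
def distVec (x z : PiLp 2 X) : EuclideanSpace ℝ ι := WithLp.toLp 2 fun i => dist (x i) (z i)

theorem norm_distVec (x z : PiLp 2 X) : ‖distVec x z‖ = dist x z := by
  rw [EuclideanSpace.norm_eq, PiLp.dist_eq_sum (by norm_num), Real.sqrt_eq_rpow]
  simp [distVec]

theorem distVec_geodesic (σ : GeodesicRay (PiLp 2 X)) {r s t : ℝ≥0} (hrs : r ≤ s) (hst : s ≤ t)
    (i : ι) :
    dist (σ.1 r i) (σ.1 t i) = dist (σ.1 r i) (σ.1 s i) + dist (σ.1 s i) (σ.1 t i) ∧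
      ((s : ℝ) - r) * dist (σ.1 s i) (σ.1 t i) = ((t : ℝ) - s) * dist (σ.1 r i) (σ.1 s i) := by
  have hn : ∀ u v : ℝ≥0, u ≤ v → ‖distVec (σ.1 u) (σ.1 v)‖ = (v : ℝ) - u := by
    intro u v huv
    rw [norm_distVec, σ.2.dist_eq, NNReal.dist_eq, abs_sub_comm, abs_of_nonneg]
    exact sub_nonneg.2 (NNReal.coe_le_coe.2 huv)
  have ha := hn r s hrs
  have hb := hn s t hst
  have hc := hn r t (hrs.trans hst)
  set a := distVec (σ.1 r) (σ.1 s) with hadef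
  set b := distVec (σ.1 s) (σ.1 t) with hbdef
  set c := distVec (σ.1 r) (σ.1 t) with hcdef
  have hle : ∀ j, c j ≤ a j + b j := fun j => dist_triangle _ _ _
  have hc0 : ∀ j, 0 ≤ c j := fun j => dist_nonneg
  have hsq : ‖c‖ ^ 2 ≤ ‖a + b‖ ^ 2 := by
    rw [EuclideanSpace.norm_sq_eq, EuclideanSpace.norm_sq_eq]
    refine Finset.sum_le_sum fun j _ => ?_
    rw [Real.norm_eq_abs, Real.norm_eq_abs, sq_abs, sq_abs]
    exact pow_le_pow_left₀ (hc0 j) (hle j) 2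
  have hcab : ‖c‖ = ‖a‖ + ‖b‖ := by rw [ha, hb, hc]; ring
  have hab : ‖a + b‖ = ‖a‖ + ‖b‖ :=
    le_antisymm (norm_add_le _ _) (hcab ▸ (abs_le_of_sq_le_sq' hsq (norm_nonneg _)).2)
  have hsum : ‖c‖ ^ 2 = ‖a + b‖ ^ 2 := by rw [hcab, hab]
  constructor
  · by_contra hne
    have hlt : c i < a i + b i := lt_of_le_of_ne (hle i) hne
    have : ‖c‖ ^ 2 < ‖a + b‖ ^ 2 := by
      rw [EuclideanSpace.norm_sq_eq, EuclideanSpace.norm_sq_eq]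
      refine Finset.sum_lt_sum (fun j _ => ?_) ⟨i, Finset.mem_univ _, ?_⟩
      · rw [Real.norm_eq_abs, Real.norm_eq_abs, sq_abs, sq_abs]
        exact pow_le_pow_left₀ (hc0 j) (hle j) 2
      · rw [Real.norm_eq_abs, Real.norm_eq_abs, sq_abs, sq_abs]
        exact pow_lt_pow_left₀ hlt (hc0 i) two_ne_zero
    exact this.ne hsum
  · have h := (sameRay_iff_norm_smul_eq.1 (sameRay_iff_norm_add.2 hab))
    rw [ha, hb] at h
    have hi := congrArg (fun v : EuclideanSpace ℝ ι => v i) h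
    simp only [PiLp.smul_apply, smul_eq_mul] at hi
    exact hi

/-- The slope of a geodesic ray in the product. -/
def GeodesicRay.slope (σ : GeodesicRay (PiLp 2 X)) : EuclideanSpace ℝ ι :=
  distVec (σ.1 0) (σ.1 1)

/-- The `i`-th projection of a ray runs through a geodesic with constant speed, the `i`-th
coordinate of the slope. -/
theorem GeodesicRay.dist_apply (σ : GeodesicRay (PiLp 2 X)) (s t : ℝ≥0) (i : ι) :
    dist (σ.1 s i) (σ.1 t i) = |(s : ℝ) - t| * GeodesicRay.slope σ i := by
  have h0 : ∀ u : ℝ≥0, dist (σ.1 0 i) (σ.1 u i) = u * GeodesicRay.slope σ i := by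
    intro u
    change _ = _ * dist (σ.1 0 i) (σ.1 1 i)
    rcases le_total u 1 with hu | hu
    · obtain ⟨h1, h2⟩ := distVec_geodesic σ (r := 0) bot_le hu i
      simp only [NNReal.coe_zero, NNReal.coe_one, sub_zero] at h2
      rw [h1]
      linarith
    · obtain ⟨h1, h2⟩ := distVec_geodesic σ (r := 0) bot_le hu i
      simp only [NNReal.coe_zero, NNReal.coe_one, sub_zero] at h2
      rw [h1]
      linarith
  have hle : ∀ u v : ℝ≥0, u ≤ v →
      dist (σ.1 u i) (σ.1 v i) = |(u : ℝ) - v| * GeodesicRay.slope σ i := by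
    intro u v huv
    have h1 := (distVec_geodesic σ (r := 0) bot_le huv i).1
    rw [h0, h0] at h1
    rw [abs_sub_comm, abs_of_nonneg (sub_nonneg.2 (NNReal.coe_le_coe.2 huv))]
    linarith
  rcases le_total s t with h | h
  · exact hle s t h
  · rw [dist_comm, abs_sub_comm]
    exact hle t s h

theorem dist_apply_le (x y : PiLp 2 X) (i : ι) : dist (x i) (y i) ≤ dist x y := by
  rw [← norm_distVec]
  exact (le_abs_self _).trans (PiLp.norm_apply_le (distVec x y) i)

theorem GeodesicRay.slope_eq {σ τ : GeodesicRay (PiLp 2 X)} (h : σ ≈ τ) :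
    GeodesicRay.slope σ = GeodesicRay.slope τ := by
  have key : ∀ {σ τ : GeodesicRay (PiLp 2 X)}, σ ≈ τ → ∀ i,
      GeodesicRay.slope σ i ≤ GeodesicRay.slope τ i := by
    rintro σ τ ⟨C, hC⟩ i
    by_contra! hlt
    obtain ⟨n, hn⟩ := exists_nat_gt (2 * C / (GeodesicRay.slope σ i - GeodesicRay.slope τ i))
    rw [div_lt_iff₀ (sub_pos.2 hlt)] at hn
    have h1 := GeodesicRay.dist_apply σ 0 n i
    have h2 := GeodesicRay.dist_apply τ 0 n i
    have h3 := (dist_apply_le _ _ i).trans (hC 0)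
    have h4 := (dist_apply_le _ _ i).trans (hC n)
    have h5 := dist_triangle4 (σ.1 0 i) (τ.1 0 i) (τ.1 n i) (σ.1 n i)
    rw [dist_comm (τ.1 n i) (σ.1 n i)] at h5
    simp only [NNReal.coe_zero, NNReal.coe_natCast, zero_sub, abs_neg, Nat.abs_cast] at h1 h2
    rw [h1, h2] at h5
    linarith
  ext i
  exact le_antisymm (key h i) (key (Setoid.symm h) i)

/-- The `i`-th projection, parametrized by arc length, of a ray that does not project to a point. -/
def GeodesicRay.component (σ : GeodesicRay (PiLp 2 X)) (i : ι) (h : 0 < GeodesicRay.slope σ i) :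
    GeodesicRay (X i) :=
  ⟨fun t => σ.1 (t / (GeodesicRay.slope σ i).toNNReal) i, Isometry.of_dist_eq fun s t => by
    rw [GeodesicRay.dist_apply, NNReal.dist_eq, NNReal.coe_div, NNReal.coe_div,
      Real.coe_toNNReal _ h.le,
      ← sub_div, abs_div, abs_of_pos h, div_mul_cancel₀ _ h.ne']⟩

/-- The slope of a boundary point of the product. -/
def Boundary.slope (ξ : Boundary (PiLp 2 X)) : EuclideanSpace ℝ ι :=
  Quotient.lift GeodesicRay.slope (fun _ _ h => GeodesicRay.slope_eq h) ξ

/-- The `i`-th projection `σ_i(∞)` of a boundary point `σ(∞)` whose slope has non-zero `i`-th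
coordinate. -/
def Boundary.component (ξ : Boundary (PiLp 2 X)) (i : ι) (h : 0 < ξ.slope i) : Boundary (X i) :=
  Quotient.hrecOn (motive := fun ξ : Boundary (PiLp 2 X) => 0 < ξ.slope i → Boundary (X i)) ξ
    (fun σ h => (GeodesicRay.component σ i h).endpoint)
    (fun σ τ hστ => by
      have hs : GeodesicRay.slope σ i = GeodesicRay.slope τ i := by
        rw [GeodesicRay.slope_eq hστ]
      refine Function.hfunext (congrArg (fun x : ℝ => 0 < x) hs) fun h h' _ => heq_of_eq ?_
      obtain ⟨C, hC⟩ := hστ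
      refine Quotient.sound ⟨C, fun t => ?_⟩
      simp only [GeodesicRay.component, hs]
      exact (dist_apply_le _ _ i).trans (hC _)) h

variable (ι) in
/-- The set `E` of unit vectors with non-negative coordinates. -/
def slopes : Set (EuclideanSpace ℝ ι) := {θ | (∀ i, 0 ≤ θ i) ∧ ‖θ‖ = 1}

variable (ι) in
/-- The set `E⁺` of unit vectors with positive coordinates. -/
def regularSlopes : Set (EuclideanSpace ℝ ι) := {θ | (∀ i, 0 < θ i) ∧ ‖θ‖ = 1}

variable (X) in
/-- The regular geometric boundary. -/
def regularBoundary : Set (Boundary (PiLp 2 X)) := {ξ | ξ.slope ∈ regularSlopes ι}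

variable (X) in
/-- The Furstenberg boundary, with the product topology. -/
abbrev FurstenbergBoundary : Type _ := ∀ i, Boundary (X i)

/-- The Furstenberg projection `π^F`. -/
def furstenbergProj (ξ : regularBoundary X) : FurstenbergBoundary X :=
  fun i => ξ.1.component i (ξ.2.1 i)

/-- A regular axial isometry: every factor is a rank one isometry. -/
def IsRegularAxial (h : ∀ i, X i ≃ᵢ X i) : Prop := ∀ i, IsRankOne (h i)

/-- The geometric limit set, computed with the base point `o`. -/
def limitSet (Γ : Subgroup (∀ i, X i ≃ᵢ X i)) (o : PiLp 2 X) : Set (Boundary (PiLp 2 X)) :=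
  {ξ | Bordification.ideal ξ ∈ closure (Bordification.point '' MulAction.orbit Γ o)}

/-- The Furstenberg limit set: the image of the regular limit points under `π^F`. -/
def furstenbergLimitSet (Γ : Subgroup (∀ i, X i ≃ᵢ X i)) (o : PiLp 2 X) :
    Set (FurstenbergBoundary X) :=
  furstenbergProj '' {ξ | ξ.1 ∈ limitSet Γ o}

/-- The set `P_Γ` of slopes of limit points. -/
def limitSlopes (Γ : Subgroup (∀ i, X i ≃ᵢ X i)) (o : PiLp 2 X) : Set (EuclideanSpace ℝ ι) :=
  {θ ∈ slopes ι | ∃ ξ ∈ limitSet Γ o, ξ.slope = θ}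

/-- The set `P_Γ^reg` of slopes of regular limit points. -/
def regularLimitSlopes (Γ : Subgroup (∀ i, X i ≃ᵢ X i)) (o : PiLp 2 X) :
    Set (EuclideanSpace ℝ ι) :=
  limitSlopes Γ o ∩ regularSlopes ι

end Products

end HadamardProduct

end

open HadamardProduct

namespace HadamardProduct

open Filter Topology Set
open scoped NNReal

/-! ### The Stewart inequality -/

/-! A ray of the product is a tuple of rays of the factors, run through at the speeds given by the
slope. So the Furstenberg projection and the slope together determine a regular boundary point, and
its topology as well: the map is injective and inducing on the whole regular boundary
(`furstenbergProj_slope_injective`, `isInducing_furstenbergProj_slope`). The group matters only for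
surjectivity: if `η` and `ξ` are regular limit points, then the point with the projection of `η` and
the slope of `ξ` is a limit point too (`endpoint_productRay_mem_limitSet`).

The limit set is closed and `Γ`-invariant, and `Γ` preserves slopes. So it suffices to find `β n ∈
Γ` such that `β n` moves the projection of `ξ` towards that of `η` in all factors at once. If `γ n •
o` tends to `η`, take `β n = γ n * (g ^ k * h ^ N * (g ^ k')⁻¹)`, where the inserted element makes
the ray from `o` to the translate of `ξ` pass, in every factor, within a constant distance of `γ n •
o`; that ray then follows the ray to `η` for a long time. Let `σ` be the axis of `h` in a factor.
The insertion works there unless `(γ n)⁻¹ • o` lies far out towards the attracting end of `g ^ k ∘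
σ` or `ξ` points to the repelling end of `g ^ k' ∘ σ`. Different exponents have different ends, so
each factor excludes at most one `k` and one `k'`, and one more exponent than there are factors is
enough (`exists_geodesics_near`, `exists_forall_not_of_card_lt`).

All of this rests on rank one axes being contracting (`exists_isContracting`). Otherwise distance
functions from far points would have slopes bounded away from one along long pieces of the axis.
Translating back and minimizing the slope yields a limit function that is affine on the axis with
slope less than one, and the directions towards the far points then span a flat half-plane
(`boundsFlatHalfPlane_of_tendsto`). -/

/-- `CAT(0)` geodesic spaces, by means of the Stewart inequality. -/
class CATZero (Y : Type*) [MetricSpace Y] : Prop where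
  exists_point : ∀ (x y : Y) (t : ℝ), 0 ≤ t → t ≤ 1 → ∃ m : Y, ∀ z,
    dist m z ^ 2 ≤ (1 - t) * dist x z ^ 2 + t * dist y z ^ 2 - t * (1 - t) * dist x y ^ 2

/-- `m` divides a geodesic from `x` to `y` in the ratio `t : 1 - t`. -/
def Between {Y : Type*} [MetricSpace Y] (t : ℝ) (x y m : Y) : Prop :=
  dist x m = t * dist x y ∧ dist m y = (1 - t) * dist x y

section Stewart

variable {Y : Type*} [MetricSpace Y]

/-- Evaluating at the two endpoints bounds both distances from above; the triangle inequality leaves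
no slack. -/
theorem between_of_stewart {x y m : Y} {t : ℝ} (h0 : 0 ≤ t) (h1 : t ≤ 1)
    (h : ∀ z, dist m z ^ 2 ≤
      (1 - t) * dist x z ^ 2 + t * dist y z ^ 2 - t * (1 - t) * dist x y ^ 2) :
    Between t x y m := by
  have hx := h x
  have hy := h y
  rw [dist_self, dist_comm y x] at hx
  rw [dist_self] at hy
  have d0 : 0 ≤ dist x y := dist_nonneg
  have h1' : 0 ≤ 1 - t := sub_nonneg.2 h1
  have ex : dist m x ≤ t * dist x y :=
    abs_le_of_sq_le_sq' (by nlinarith) (by positivity) |>.2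
  have ey : dist m y ≤ (1 - t) * dist x y :=
    abs_le_of_sq_le_sq' (by nlinarith) (by positivity) |>.2
  have := dist_triangle x m y
  rw [dist_comm m x] at ex
  constructor <;> linarith

theorem Between.symm {t : ℝ} {x y m : Y} (h : Between t x y m) : Between (1 - t) y x m := by
  refine ⟨?_, ?_⟩
  · rw [dist_comm y m, dist_comm y x]; exact h.2
  · rw [dist_comm m x, dist_comm y x, h.1]; ring

variable [CATZero Y]

/-- The class only provides some point with the inequality. Evaluated at `m`, its right-hand side
vanishes, so that point is `m`. -/
theorem Between.stewart {t : ℝ} {x y m : Y} (h : Between t x y m) (h0 : 0 ≤ t) (h1 : t ≤ 1)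
    (z : Y) : dist m z ^ 2 ≤
      (1 - t) * dist x z ^ 2 + t * dist y z ^ 2 - t * (1 - t) * dist x y ^ 2 := by
  obtain ⟨n, hn⟩ := CATZero.exists_point x y t h0 h1
  have h2 := hn m
  rw [h.1, dist_comm y m, h.2] at h2
  have h3 : dist n m ^ 2 ≤ 0 := by nlinarith
  have h4 : n = m := dist_eq_zero.1 (pow_eq_zero_iff two_ne_zero |>.1 (le_antisymm h3 (sq_nonneg _)))
  rw [← h4]
  exact hn z

theorem Between.unique {t : ℝ} {x y m n : Y} (h : Between t x y m) (k : Between t x y n)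
    (h0 : 0 ≤ t) (h1 : t ≤ 1) : m = n := by
  have h2 := h.stewart h0 h1 n
  rw [k.1, dist_comm y n, k.2] at h2
  exact dist_eq_zero.1 (pow_eq_zero_iff two_ne_zero |>.1 (le_antisymm (by nlinarith) (sq_nonneg _)))

/-- The comparison inequality for two sides that issue from a common vertex. -/
theorem Between.cat {s t : ℝ} {x y z p q : Y} (hp : Between s x y p) (hq : Between t x z q)
    (s0 : 0 ≤ s) (s1 : s ≤ 1) (t0 : 0 ≤ t) (t1 : t ≤ 1) :
    dist p q ^ 2 ≤ s ^ 2 * dist x y ^ 2 + t ^ 2 * dist x z ^ 2 -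
      s * t * (dist x y ^ 2 + dist x z ^ 2 - dist y z ^ 2) := by
  have h1 := hp.stewart s0 s1 q
  have h2 := hq.stewart t0 t1 y
  rw [hq.1] at h1
  rw [dist_comm q y, dist_comm z y] at h2
  nlinarith [mul_le_mul_of_nonneg_left h2 s0]

theorem Between.dist_le_mul {s : ℝ} {x y z p q : Y} (hp : Between s x y p) (hq : Between s x z q)
    (s0 : 0 ≤ s) (s1 : s ≤ 1) : dist p q ≤ s * dist y z := by
  have := hp.cat hq s0 s1 s0 s1
  exact abs_le_of_sq_le_sq' (by nlinarith) (mul_nonneg s0 dist_nonneg) |>.2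

theorem exists_between (x y : Y) {t : ℝ} (h0 : 0 ≤ t) (h1 : t ≤ 1) : ∃ m, Between t x y m := by
  obtain ⟨m, hm⟩ := CATZero.exists_point x y t h0 h1
  exact ⟨m, between_of_stewart h0 h1 hm⟩

/-- The distance between two geodesics is convex. -/
theorem Between.dist_le {s : ℝ} {x y x' y' p q : Y} (hp : Between s x y p)
    (hq : Between s x' y' q) (s0 : 0 ≤ s) (s1 : s ≤ 1) :
    dist p q ≤ (1 - s) * dist x x' + s * dist y y' := by
  obtain ⟨m, hm⟩ := exists_between x y' s0 s1
  have h1 := hp.dist_le_mul hm s0 s1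
  have h2 := hm.symm.dist_le_mul hq.symm (by linarith) (by linarith)
  linarith [dist_triangle p m q]

/-- The distance to a point is convex along a geodesic. -/
theorem Between.dist_point_le {s : ℝ} {x y p : Y} (hp : Between s x y p) (s0 : 0 ≤ s) (s1 : s ≤ 1)
    (z : Y) : dist p z ≤ (1 - s) * dist x z + s * dist y z :=
  hp.dist_le (x' := z) (y' := z) ⟨by simp, by simp⟩ s0 s1

end Stewart

/-! ### Geodesic paths -/

section Paths

variable {Y : Type*} [MetricSpace Y]

theorem IsGeodesicPath.between {c : ℝ → Y} {L : ℝ} (hc : IsGeodesicPath c L) {t : ℝ} (h0 : 0 ≤ t)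
    (h1 : t ≤ 1) : Between t (c 0) (c L) (c (t * L)) := by
  have hL := hc.1
  have m0 : (0 : ℝ) ∈ Icc 0 L := ⟨le_rfl, hL⟩
  have mL : L ∈ Icc 0 L := ⟨hL, le_rfl⟩
  have mt : t * L ∈ Icc 0 L := ⟨by positivity, by nlinarith⟩
  refine ⟨?_, ?_⟩
  · rw [hc.2 _ m0 _ mt, hc.2 _ m0 _ mL, zero_sub, zero_sub, abs_neg, abs_neg, abs_of_nonneg hL,
      abs_of_nonneg mt.1]
  · rw [hc.2 _ mt _ mL, hc.2 _ m0 _ mL, zero_sub, abs_neg, abs_of_nonneg hL, abs_sub_comm,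
      abs_of_nonneg (by linarith [mt.2])]
    ring

theorem IsGeodesicPath.dist_zero {c : ℝ → Y} {L : ℝ} (hc : IsGeodesicPath c L) {t : ℝ}
    (h0 : 0 ≤ t) (h1 : t ≤ L) : dist (c 0) (c t) = t := by
  rw [hc.2 0 ⟨le_rfl, hc.1⟩ t ⟨h0, h1⟩, zero_sub, abs_neg, abs_of_nonneg h0]

theorem IsGeodesicPath.mono {c : ℝ → Y} {L M : ℝ} (hc : IsGeodesicPath c L) (h0 : 0 ≤ M)
    (h : M ≤ L) : IsGeodesicPath c M :=
  ⟨h0, fun s hs t ht => hc.2 s ⟨hs.1, hs.2.trans h⟩ t ⟨ht.1, ht.2.trans h⟩⟩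

theorem IsGeodesicPath.reverse {c : ℝ → Y} {L : ℝ} (hc : IsGeodesicPath c L) :
    IsGeodesicPath (fun t => c (L - t)) L := by
  refine ⟨hc.1, fun s hs t ht => ?_⟩
  rw [hc.2 _ ⟨by linarith [hs.2], by linarith [hs.1]⟩ _ ⟨by linarith [ht.2], by linarith [ht.1]⟩,
    abs_sub_comm]
  congr 1; ring

theorem IsGeodesicPath.map {Z : Type*} [MetricSpace Z] {c : ℝ → Y} {L : ℝ}
    (hc : IsGeodesicPath c L) {f : Y → Z} (hf : Isometry f) :
    IsGeodesicPath (fun t => f (c t)) L :=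
  ⟨hc.1, fun s hs t ht => by rw [hf.dist_eq]; exact hc.2 s hs t ht⟩

theorem isGeodesicPath_of_line {σ : ℝ → Y} (hσ : Isometry σ) (a : ℝ) {L : ℝ} (hL : 0 ≤ L) :
    IsGeodesicPath (fun t => σ (a + t)) L :=
  ⟨hL, fun s _ t _ => by rw [hσ.dist_eq, Real.dist_eq]; congr 1; ring⟩

theorem between_of_line {σ : ℝ → Y} (hσ : Isometry σ) {a b s : ℝ} (h0 : 0 ≤ s) (h1 : s ≤ 1) :
    Between s (σ a) (σ b) (σ ((1 - s) * a + s * b)) := by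
  refine ⟨?_, ?_⟩ <;> rw [hσ.dist_eq, hσ.dist_eq, Real.dist_eq, Real.dist_eq]
  · rw [show a - ((1 - s) * a + s * b) = s * (a - b) by ring, abs_mul, abs_of_nonneg h0]
  · rw [show (1 - s) * a + s * b - b = (1 - s) * (a - b) by ring, abs_mul,
      abs_of_nonneg (by linarith : 0 ≤ 1 - s)]

/-- Every ray is a geodesic path. -/
theorem GeodesicRay.isGeodesicPath (τ : GeodesicRay Y) {L : ℝ} (hL : 0 ≤ L) :
    IsGeodesicPath (fun t => τ.1 t.toNNReal) L :=
  ⟨hL, fun s hs t ht => by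
    rw [τ.2.dist_eq, NNReal.dist_eq, Real.coe_toNNReal _ hs.1, Real.coe_toNNReal _ ht.1]⟩

theorem GeodesicRay.dist_eq (τ : GeodesicRay Y) (s t : ℝ≥0) :
    dist (τ.1 s) (τ.1 t) = |(s : ℝ) - t| := by
  rw [τ.2.dist_eq, NNReal.dist_eq]

variable [CATZero Y]

-- One dividing point is chosen for each ratio. That they fit together to a geodesic is the
-- comparison inequality for the degenerate triangle `x, y, y`, which bounds their mutual distances
-- from above; the triangle inequality bounds them from below.
open Classical in
theorem exists_isGeodesicPath (x y : Y) :
    ∃ c : ℝ → Y, IsGeodesicPath c (dist x y) ∧ c 0 = x ∧ c (dist x y) = y := by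
  rcases eq_or_ne x y with rfl | hxy
  · refine ⟨fun _ => x, ⟨dist_nonneg, fun s hs t ht => ?_⟩, rfl, rfl⟩
    rw [dist_self] at hs ht ⊢
    rw [le_antisymm hs.2 hs.1, le_antisymm ht.2 ht.1]; simp
  have hd : 0 < dist x y := dist_pos.2 hxy
  have key : ∀ t : Icc (0 : ℝ) 1, ∃ m, Between t.1 x y m := fun t => exists_between x y t.2.1 t.2.2
  choose m hm using key
  set c : ℝ → Y := fun t => if h : t / dist x y ∈ Icc (0 : ℝ) 1 then m ⟨_, h⟩ else x with hc
  have hcm : ∀ t ∈ Icc 0 (dist x y), Between (t / dist x y) x y (c t) := by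
    intro t ht
    have h : t / dist x y ∈ Icc (0 : ℝ) 1 :=
      ⟨div_nonneg ht.1 hd.le, (div_le_one hd).2 ht.2⟩
    simp only [hc, dif_pos h]
    exact hm ⟨_, h⟩
  have hle : ∀ s ∈ Icc 0 (dist x y), ∀ t ∈ Icc 0 (dist x y), s ≤ t → dist (c s) (c t) = t - s := by
    intro s hs t ht hst
    have b1 := hcm s hs
    have b2 := hcm t ht
    have e1 := b1.1
    have e2 := b1.2
    have e3 := b2.1
    have e4 := b2.2
    have q1 : (1 - s / dist x y) * dist x y = dist x y - s := by field_simp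
    have q2 : (1 - t / dist x y) * dist x y = dist x y - t := by field_simp
    rw [div_mul_cancel₀ _ hd.ne'] at e1 e3
    rw [q1] at e2
    rw [q2] at e4
    refine le_antisymm ?_ (by linarith [dist_triangle x (c s) (c t)])
    have h := b1.cat b2 (div_nonneg hs.1 hd.le) ((div_le_one hd).2 hs.2)
      (div_nonneg ht.1 hd.le) ((div_le_one hd).2 ht.2)
    rw [dist_self] at h
    refine (abs_le_of_sq_le_sq' (h.trans (le_of_eq ?_)) (by linarith)).2
    field_simp
    ring
  refine ⟨c, ⟨hd.le, fun s hs t ht => ?_⟩, ?_, ?_⟩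
  · rcases le_total s t with h | h
    · rw [hle s hs t ht h, abs_sub_comm, abs_of_nonneg (by linarith)]
    · rw [dist_comm, hle t ht s hs h, abs_of_nonneg (by linarith)]
  · have := (hcm 0 ⟨le_rfl, hd.le⟩).1
    rw [zero_div, zero_mul] at this
    exact (dist_eq_zero.1 this).symm
  · have := (hcm _ ⟨hd.le, le_rfl⟩).2
    rw [div_self hd.ne', sub_self, zero_mul] at this
    exact dist_eq_zero.1 this

/-- Two geodesic paths with the same end diverge at most as far as their origins. -/
theorem IsGeodesicPath.dist_le_of_eq_end {c c' : ℝ → Y} {L L' : ℝ} (hc : IsGeodesicPath c L)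
    (hc' : IsGeodesicPath c' L') (he : c L = c' L') {t : ℝ} (h0 : 0 ≤ t) (h1 : t ≤ L)
    (h2 : t ≤ L') : dist (c t) (c' t) ≤ dist (c 0) (c' 0) := by
  rcases hc.1.eq_or_lt with h | hL
  · obtain rfl : t = 0 := by linarith
    exact le_rfl
  have ht1 : t / L ≤ 1 := (div_le_one hL).2 h1
  have ht0 : 0 ≤ t / L := by positivity
  have h3 := (hc.between ht0 ht1).dist_le (hc'.between ht0 ht1) ht0 ht1
  rw [div_mul_cancel₀ _ hL.ne', he, dist_self, mul_zero, add_zero] at h3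
  have h4 : dist (c' (t / L * L')) (c' t) = t / L * |L' - L| := by
    rw [hc'.2 _ ⟨by have := hc'.1; positivity, mul_le_of_le_one_left hc'.1 ht1⟩ _ ⟨h0, h2⟩,
      show t / L * L' - t = t / L * (L' - L) by field_simp, abs_mul, abs_of_nonneg ht0]
  have h5 : |L' - L| ≤ dist (c 0) (c' 0) := by
    have e1 := hc.dist_zero hc.1 le_rfl
    have e2 := hc'.dist_zero hc'.1 le_rfl
    rw [← he] at e2
    rw [← e1, ← e2, abs_sub_comm]
    have := abs_dist_sub_le (c 0) (c' 0) (c L)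
    exact this
  have := dist_triangle (c t) (c' (t / L * L')) (c' t)
  nlinarith [mul_le_mul_of_nonneg_left h5 ht0]

theorem IsGeodesicPath.dist_le_mul {c c' : ℝ → Y} {L : ℝ} (hc : IsGeodesicPath c L)
    (hc' : IsGeodesicPath c' L) (he : c 0 = c' 0) {t : ℝ} (h0 : 0 ≤ t) (h1 : t ≤ L) (hL : 0 < L) :
    dist (c t) (c' t) ≤ t / L * dist (c L) (c' L) := by
  have ht1 : t / L ≤ 1 := (div_le_one hL).2 h1
  have ht0 : 0 ≤ t / L := by positivity
  have h3 := (hc.between ht0 ht1).dist_le (hc'.between ht0 ht1) ht0 ht1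
  rwa [div_mul_cancel₀ _ hL.ne', he, dist_self, mul_zero, zero_add] at h3

end Paths

/-! ### Hadamard spaces -/

section Hadamard

variable {Y : Type*} [MetricSpace Y]

theorem exists_triangle {a b c : ℝ} (ha : 0 ≤ a) (hb : 0 ≤ b) (hc : 0 ≤ c) (h1 : a ≤ b + c)
    (h2 : b ≤ a + c) (h3 : c ≤ a + b) :
    ∃ p q r : EuclideanSpace ℝ (Fin 2), dist p q = a ∧ dist p r = b ∧ dist q r = c := by
  rcases ha.eq_or_lt with rfl | ha
  · obtain rfl : b = c := by linarith
    exact ⟨!₂[0, 0], !₂[0, 0], !₂[b, 0], by simp, by simp [EuclideanSpace.dist_eq, Real.sqrt_sq hb],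
      by simp [EuclideanSpace.dist_eq, Real.sqrt_sq hb]⟩
  set u := (a ^ 2 + b ^ 2 - c ^ 2) / (2 * a) with hu
  have hua : 2 * a * u = a ^ 2 + b ^ 2 - c ^ 2 := by rw [hu]; field_simp
  have hv : 0 ≤ b ^ 2 - u ^ 2 := by
    have h4 : u ≤ b := by
      rw [hu, div_le_iff₀ (by positivity)]; nlinarith
    have h5 : -b ≤ u := by
      rw [hu, le_div_iff₀ (by positivity)]; nlinarith
    nlinarith
  refine ⟨!₂[0, 0], !₂[a, 0], !₂[u, √(b ^ 2 - u ^ 2)], ?_, ?_, ?_⟩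
  · simp [EuclideanSpace.dist_eq, Real.sqrt_sq ha.le]
  · simp [EuclideanSpace.dist_eq, Real.dist_eq, Real.sq_sqrt hv, hb]
  · simp [EuclideanSpace.dist_eq, Real.dist_eq, Real.sq_sqrt hv]
    rw [show (a - u) ^ 2 + (b ^ 2 - u ^ 2) = c ^ 2 by linarith, Real.sqrt_sq hc]

theorem dist_lineMap_sq {V : Type*} [NormedAddCommGroup V] [InnerProductSpace ℝ V] (p q r : V)
    (t : ℝ) : dist q (AffineMap.lineMap p r t) ^ 2 =
      (1 - t) * dist p q ^ 2 + t * dist r q ^ 2 - t * (1 - t) * dist p r ^ 2 := by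
  have e : q - AffineMap.lineMap p r t = (1 - t) • (q - p) + t • (q - r) := by
    rw [AffineMap.lineMap_apply_module]; module
  have e2 : p - r = (q - r) - (q - p) := by abel
  rw [dist_eq_norm q, e, dist_comm p q, dist_comm r q, dist_eq_norm q p, dist_eq_norm q r,
    dist_eq_norm p r, e2]
  generalize q - p = a
  generalize q - r = b
  rw [norm_add_sq_real, norm_sub_sq_real, norm_smul, norm_smul, mul_pow, mul_pow, inner_smul_left,
    inner_smul_right, Real.norm_eq_abs, Real.norm_eq_abs, sq_abs, sq_abs, real_inner_comm]
  simp only [conj_trivial]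
  ring

/-- The `CAT(0)` inequality with one point at the vertex `z` compares the distance to the opposite
side with its Euclidean value, which Stewart's theorem computes exactly. -/
theorem IsHadamard.catZero (h : IsHadamard Y) : CATZero Y := by
  refine ⟨fun x y t h0 h1 => ?_⟩
  obtain ⟨c, hc, cx, cy⟩ := h.exists_geodesic x y
  refine ⟨c (t * dist x y), fun z => ?_⟩
  obtain ⟨e, he, ex, ez⟩ := h.exists_geodesic x z
  obtain ⟨p, q, r, h2, h3, h4⟩ := exists_triangle (dist_nonneg (x := x) (y := z))
    (dist_nonneg (x := x) (y := y)) (dist_nonneg (x := z) (y := y)) (dist_triangle_right _ _ _ )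
    (dist_triangle x z y) (by
      have := dist_triangle z x y
      rwa [dist_comm z x] at this)
  have h5 := h.cat_zero e c _ _ he hc (by rw [ex, cx]) p q r h2 h3 (by rw [h4, ez, cy]) 1
    ⟨by norm_num, le_rfl⟩ t ⟨h0, h1⟩
  rw [one_mul, ez, AffineMap.lineMap_apply_one, dist_comm] at h5
  refine (pow_le_pow_left₀ dist_nonneg h5 2).trans (le_of_eq ?_)
  rw [dist_lineMap_sq, h2, h3, dist_comm r q, h4, dist_comm z y]

/-- The Hopf-Rinow theorem. -/
theorem properSpace_of_geodesic [CompleteSpace Y] [LocallyCompactSpace Y] [CATZero Y] :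
    ProperSpace Y := by
  have push : ∀ (x y : Y) (r δ : ℝ), 0 ≤ r → 0 ≤ δ → dist y x ≤ r + δ →
      ∃ z ∈ Metric.closedBall x r, dist y z ≤ δ := by
    intro x y r δ hr hδ hy
    rcases le_total (dist y x) r with h | h
    · exact ⟨y, h, by simpa⟩
    obtain ⟨c, hc, cx, cy⟩ := exists_isGeodesicPath x y
    rw [dist_comm] at hy h
    refine ⟨c r, ?_, ?_⟩
    · rw [Metric.mem_closedBall, dist_comm]
      nth_rw 1 [← cx]
      rw [hc.dist_zero hr h]
    · nth_rw 1 [← cy]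
      rw [hc.2 _ ⟨dist_nonneg, le_rfl⟩ _ ⟨hr, h⟩, abs_of_nonneg (by linarith)]
      linarith
  have all : ∀ x : Y, ∀ R : ℝ, IsCompact (Metric.closedBall x R) := by
    intro x R
    by_contra hR
    -- The supremum of the radii of compact balls is attained, since the ball of that radius lies
    -- close to smaller compact ones and is complete; local compactness then allows a larger radius,
    -- a contradiction.
    set S : Set ℝ := {r | 0 ≤ r ∧ IsCompact (Metric.closedBall x r)} with hS
    have down : ∀ r s, s ≤ r → IsCompact (Metric.closedBall x r) →
        IsCompact (Metric.closedBall x s) := fun r s hs hr =>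
      hr.of_isClosed_subset Metric.isClosed_closedBall (Metric.closedBall_subset_closedBall hs)
    have hbdd : BddAbove S := ⟨R, fun r hr => by
      by_contra! hlt
      exact hR (down _ _ hlt.le hr.2)⟩
    have h0 : (0 : ℝ) ∈ S := ⟨le_rfl, by simp⟩
    have hlt : ∀ r, r < sSup S → IsCompact (Metric.closedBall x r) := by
      intro r hr
      obtain ⟨s, hs, hrs⟩ := exists_lt_of_lt_csSup ⟨0, h0⟩ hr
      exact down _ _ hrs.le hs.2
    have hs0 : 0 ≤ sSup S := le_csSup hbdd h0
    have hcomp : IsCompact (Metric.closedBall x (sSup S)) := by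
      rw [isCompact_iff_totallyBounded_isComplete]
      refine ⟨Metric.totallyBounded_iff.2 fun ε hε => ?_, Metric.isClosed_closedBall.isComplete⟩
      rcases le_total (sSup S) (ε / 2) with hsm | hsm
      · refine ⟨{x}, Set.finite_singleton _, fun y hy => ?_⟩
        have := Metric.mem_closedBall.1 hy
        simp only [mem_singleton_iff, iUnion_iUnion_eq_left, Metric.mem_ball]
        linarith
      have hc := hlt (sSup S - ε / 2) (by linarith)
      obtain ⟨t, ht, hcov⟩ := Metric.totallyBounded_iff.1 hc.totallyBounded (ε / 2) (by linarith)
      refine ⟨t, ht, fun y hy => ?_⟩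
      obtain ⟨z, hz, hyz⟩ := push x y (sSup S - ε / 2) (ε / 2) (by linarith) (by linarith)
        (by linarith [Metric.mem_closedBall.1 hy])
      obtain ⟨w, hw, hzw⟩ := mem_iUnion₂.1 (hcov hz)
      refine mem_iUnion₂.2 ⟨w, hw, ?_⟩
      rw [Metric.mem_ball] at hzw ⊢
      linarith [dist_triangle y z w]
    obtain ⟨δ, hδ, hK⟩ := hcomp.exists_isCompact_cthickening
    have : sSup S + δ ∈ S := by
      refine ⟨by linarith, hK.of_isClosed_subset Metric.isClosed_closedBall fun y hy => ?_⟩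
      obtain ⟨z, hz, hyz⟩ := push x y (sSup S) δ hs0 hδ.le (Metric.mem_closedBall.1 hy)
      exact Metric.mem_cthickening_of_dist_le y z δ _ hz hyz
    linarith [le_csSup hbdd this]
  exact ⟨all⟩

/-- In a proper space, bounded sequences converge along ultrafilters. -/
theorem exists_tendsto_of_bounded [ProperSpace Y] {α : Type*} (𝓤 : Ultrafilter α) (f : α → Y)
    (x : Y) (C : ℝ) (h : ∀ᶠ n in (𝓤 : Filter α), dist (f n) x ≤ C) :
    ∃ y, Tendsto f 𝓤 (𝓝 y) := by
  obtain ⟨y, -, hy⟩ := (isCompact_closedBall x C).ultrafilter_le_nhds (𝓤.map f)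
    (le_principal_iff.2 h)
  exact ⟨y, hy⟩

end Hadamard

/-! ### Flat half-planes -/

section HalfPlane

variable {Y : Type*} [MetricSpace Y] [CATZero Y]

/-- `x u t` is a limit of the points at distance `u` from `σ t` on the geodesics towards `y n`.
Comparison in the triangles with apex `y n` passes to the limit and gives the metric of a flat
sector, with `c` as the cosine, as an upper bound. -/
theorem exists_limit_sector [ProperSpace Y] {σ : ℝ → Y} (hσ : Isometry σ) {y : ℕ → Y} {c : ℝ}
    (h1 : Tendsto (fun n => dist (y n) (σ 0)) atTop atTop)
    (h2 : ∀ t, Tendsto (fun n => dist (y n) (σ t) - dist (y n) (σ 0)) atTop (𝓝 (c * t))) :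
    ∃ x : ℝ≥0 → ℝ → Y, (∀ u t, dist (x u t) (σ t) = u) ∧ ∀ u t v s, dist (x u t) (x v s) ^ 2 ≤
      (t - s) ^ 2 - 2 * c * (t - s) * ((u : ℝ) - v) + ((u : ℝ) - v) ^ 2 := by
  -- The minimum only keeps the ratio in `[0, 1]` for the finitely many `n` for which `y n` is not
  -- yet far enough away.
  have hw : ∀ n (u : ℝ≥0) t, 0 ≤ 1 - min ((u : ℝ) / dist (y n) (σ t)) 1 ∧
      1 - min ((u : ℝ) / dist (y n) (σ t)) 1 ≤ 1 := fun n u t =>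
    ⟨by linarith [min_le_right ((u : ℝ) / dist (y n) (σ t)) 1],
      by linarith [le_min (div_nonneg u.coe_nonneg (dist_nonneg (x := y n) (y := σ t))) zero_le_one]⟩
  have hex : ∀ n (u : ℝ≥0) t, ∃ m, Between (1 - min ((u : ℝ) / dist (y n) (σ t)) 1) (y n) (σ t) m :=
    fun n u t => exists_between _ _ (hw n u t).1 (hw n u t).2
  choose P hP using hex
  have hfar : ∀ t, Tendsto (fun n => dist (y n) (σ t)) atTop atTop := by
    intro t
    have := h1.atTop_add (h2 t)
    refine this.congr fun n => by ring
  have hev : ∀ (u : ℝ≥0) t, ∀ᶠ n in atTop, (u : ℝ) < dist (y n) (σ t) := fun u t =>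
    (hfar t).eventually_gt_atTop _
  have hu : ∀ (u : ℝ≥0) t n, (u : ℝ) < dist (y n) (σ t) →
      Between (1 - (u : ℝ) / dist (y n) (σ t)) (y n) (σ t) (P n u t) := by
    intro u t n hn
    have := hP n u t
    rwa [min_eq_left ((div_le_one (u.2.trans_lt hn)).2 hn.le)] at this
  have hdist : ∀ (u : ℝ≥0) t, ∀ᶠ n in (hyperfilter ℕ : Filter ℕ), dist (P n u t) (σ t) = u := by
    intro u t
    filter_upwards [Nat.hyperfilter_le_atTop (hev u t)] with n hn
    rw [(hu u t n hn).2, sub_sub_cancel, div_mul_cancel₀ _ (u.2.trans_lt hn).ne']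
  have hlim : ∀ (u : ℝ≥0) t, ∃ x, Tendsto (fun n => P n u t) (hyperfilter ℕ : Filter ℕ) (𝓝 x) :=
    fun u t => exists_tendsto_of_bounded _ _ (σ t) u ((hdist u t).mono fun n hn => hn.le)
  choose x hx using hlim
  refine ⟨x, fun u t => ?_, fun u t v s => ?_⟩
  · exact tendsto_nhds_unique ((hx u t).dist tendsto_const_nhds)
      (tendsto_const_nhds.congr' ((hdist u t).mono fun n hn => hn.symm))
  · have hab : Tendsto (fun n => dist (y n) (σ t) - dist (y n) (σ s)) atTop (𝓝 (c * t - c * s)) :=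
      ((h2 t).sub (h2 s)).congr fun n => by ring
    have hdiv : ∀ (u : ℝ≥0) t, Tendsto (fun n => 1 - (u : ℝ) / dist (y n) (σ t)) atTop (𝓝 (1 - 0)) :=
      fun u t => tendsto_const_nhds.sub (tendsto_const_nhds.div_atTop (hfar t))
    have hR : Tendsto (fun n => ((dist (y n) (σ t) - dist (y n) (σ s)) - ((u : ℝ) - v)) ^ 2 +
        (1 - (u : ℝ) / dist (y n) (σ t)) * (1 - (v : ℝ) / dist (y n) (σ s)) *
          ((t - s) ^ 2 - (dist (y n) (σ t) - dist (y n) (σ s)) ^ 2)) (hyperfilter ℕ : Filter ℕ)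
        (𝓝 (((c * t - c * s) - ((u : ℝ) - v)) ^ 2 +
          (1 - 0) * (1 - 0) * ((t - s) ^ 2 - (c * t - c * s) ^ 2))) :=
      Tendsto.mono_left (((hab.sub tendsto_const_nhds).pow 2).add
        (((hdiv u t).mul (hdiv v s)).mul (tendsto_const_nhds.sub (hab.pow 2))))
        Nat.hyperfilter_le_atTop
    have hle := le_of_tendsto_of_tendsto (((hx u t).dist (hx v s)).pow 2) hR (by
      filter_upwards [Nat.hyperfilter_le_atTop (hev u t), Nat.hyperfilter_le_atTop (hev v s)]
        with n hn1 hn2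
      have hp : 0 < dist (y n) (σ t) := u.2.trans_lt hn1
      have hq : 0 < dist (y n) (σ s) := v.2.trans_lt hn2
      refine ((hu u t n hn1).cat (hu v s n hn2) (sub_nonneg.2 ((div_le_one hp).2 hn1.le))
        (by linarith [div_nonneg u.coe_nonneg hp.le]) (sub_nonneg.2 ((div_le_one hq).2 hn2.le))
        (by linarith [div_nonneg v.coe_nonneg hq.le])).trans (le_of_eq ?_)
      rw [hσ.dist_eq, Real.dist_eq, sq_abs]
      field_simp
      ring)
    refine hle.trans (le_of_eq ?_)
    ring

/-- `σ t` is the midpoint of `σ s` and `σ (2 * t - s)`. The upper bounds for these two points turn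
the Stewart inequality at `x u t` into an equality, so both are attained. -/
theorem dist_sector_line {σ : ℝ → Y} (hσ : Isometry σ) {c : ℝ} {x : ℝ≥0 → ℝ → Y}
    (h0 : ∀ u t, dist (x u t) (σ t) = u)
    (h : ∀ u t v s, dist (x u t) (x v s) ^ 2 ≤
      (t - s) ^ 2 - 2 * c * (t - s) * ((u : ℝ) - v) + ((u : ℝ) - v) ^ 2) (u : ℝ≥0) (t s : ℝ) :
    dist (x u t) (σ s) ^ 2 = (t - s) ^ 2 - 2 * c * (t - s) * u + (u : ℝ) ^ 2 := by
  have hz : ∀ s, x 0 s = σ s := fun s => dist_eq_zero.1 (h0 0 s)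
  have hle : ∀ s, dist (x u t) (σ s) ^ 2 ≤ (t - s) ^ 2 - 2 * c * (t - s) * u + (u : ℝ) ^ 2 := by
    intro s
    rw [← hz]
    refine (h u t 0 s).trans (le_of_eq ?_)
    simp
  refine le_antisymm (hle s) ?_
  have hb := between_of_line hσ (a := s) (b := 2 * t - s) (s := 1 / 2) (by norm_num) (by norm_num)
  rw [show (1 - 1 / 2) * s + 1 / 2 * (2 * t - s) = t by ring] at hb
  have h1 := hb.stewart (by norm_num) (by norm_num) (x u t)
  rw [dist_comm, h0, hσ.dist_eq, Real.dist_eq, sq_abs, dist_comm (σ s), dist_comm (σ (2 * t - s))]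
    at h1
  have h2 := hle (2 * t - s)
  nlinarith

/-- In the flat model the segment through the two points is prolonged until it meets the line.
Distances to the line are already exact, so the triangle inequality supplies the missing lower
bound. -/
theorem dist_sector {σ : ℝ → Y} (hσ : Isometry σ) {c : ℝ} {x : ℝ≥0 → ℝ → Y}
    (h0 : ∀ u t, dist (x u t) (σ t) = u)
    (h : ∀ u t v s, dist (x u t) (x v s) ^ 2 ≤
      (t - s) ^ 2 - 2 * c * (t - s) * ((u : ℝ) - v) + ((u : ℝ) - v) ^ 2) (u : ℝ≥0) (t : ℝ)
    (v : ℝ≥0) (s : ℝ) : dist (x u t) (x v s) =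
      √((t - s) ^ 2 - 2 * c * (t - s) * ((u : ℝ) - v) + ((u : ℝ) - v) ^ 2) := by
  have hup : ∀ u t v s, dist (x u t) (x v s) ≤
      √((t - s) ^ 2 - 2 * c * (t - s) * ((u : ℝ) - v) + ((u : ℝ) - v) ^ 2) :=
    fun u t v s => Real.le_sqrt_of_sq_le (h u t v s)
  have hlt : ∀ (u v : ℝ≥0) t s, v < u →
      √((t - s) ^ 2 - 2 * c * (t - s) * ((u : ℝ) - v) + ((u : ℝ) - v) ^ 2) ≤
        dist (x u t) (x v s) := by
    intro u v t s hvu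
    have hu : (0 : ℝ) < u := lt_of_le_of_lt v.2 (NNReal.coe_lt_coe.2 hvu)
    have hvu' : (v : ℝ) < u := NNReal.coe_lt_coe.2 hvu
    set k : ℝ := (v : ℝ) / u with hk
    have hk0 : 0 ≤ k := div_nonneg v.coe_nonneg hu.le
    have hk1 : k < 1 := (div_lt_one hu).2 hvu'
    have hv : (v : ℝ) = k * u := by rw [hk]; field_simp
    -- The point where the prolonged segment meets the line: in the model, `(v, s) = k • (u, t) + (1
    -- - k) • (0, r)`.
    set r : ℝ := (s - k * t) / (1 - k) with hr
    have hs : s = k * t + (1 - k) * r := by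
      have : 1 - k ≠ 0 := by linarith
      rw [hr]; field_simp; ring
    set e : ℝ := (t - r) ^ 2 - 2 * c * (t - r) * u + (u : ℝ) ^ 2 with he
    have e1 : dist (x u t) (σ r) = √e := by
      rw [he, ← dist_sector_line hσ h0 h, Real.sqrt_sq dist_nonneg]
    have e2 : dist (x v s) (σ r) = k * √e := by
      rw [← Real.sqrt_sq (dist_nonneg (x := x v s)), dist_sector_line hσ h0 h,
        show (s - r) ^ 2 - 2 * c * (s - r) * (v : ℝ) + (v : ℝ) ^ 2 = k ^ 2 * e by
          rw [hv, hs, he]; ring,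
        Real.sqrt_mul (sq_nonneg _), Real.sqrt_sq hk0]
    have e3 : √((t - s) ^ 2 - 2 * c * (t - s) * ((u : ℝ) - v) + ((u : ℝ) - v) ^ 2) =
        (1 - k) * √e := by
      rw [show (t - s) ^ 2 - 2 * c * (t - s) * ((u : ℝ) - v) + ((u : ℝ) - v) ^ 2 =
        (1 - k) ^ 2 * e by rw [hv, hs, he]; ring, Real.sqrt_mul (sq_nonneg _),
        Real.sqrt_sq (by linarith)]
    have := dist_triangle (x u t) (x v s) (σ r)
    rw [e1, e2] at this
    rw [e3]
    linarith
  refine le_antisymm (hup u t v s) ?_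
  rcases lt_trichotomy v u with hvu | rfl | huv
  · exact hlt u v t s hvu
  -- The segment is now parallel to the line and never meets it; the first point is raised by `1 /
  -- (n + 1)` and the limit is taken.
  · have hlim : Tendsto (fun n : ℕ => √((t - s) ^ 2 - 2 * c * (t - s) *
        (((v + 1 / ((n : ℝ≥0) + 1) : ℝ≥0) : ℝ) - v) +
        (((v + 1 / ((n : ℝ≥0) + 1) : ℝ≥0) : ℝ) - v) ^ 2) - 1 / ((n : ℝ) + 1)) atTop
        (𝓝 (√((t - s) ^ 2 - 2 * c * (t - s) * ((v : ℝ) - v) + ((v : ℝ) - v) ^ 2) - 0)) := by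
      have h3 : Tendsto (fun n : ℕ => (((v + 1 / ((n : ℝ≥0) + 1) : ℝ≥0) : ℝ) - v)) atTop
          (𝓝 ((v : ℝ) - v)) := by
        refine Tendsto.sub ?_ tendsto_const_nhds
        have := (tendsto_const_nhds (x := (v : ℝ))).add
          (tendsto_one_div_add_atTop_nhds_zero_nat (𝕜 := ℝ))
        rw [add_zero] at this
        refine this.congr fun n => by push_cast; ring
      exact Tendsto.sub ((Real.continuous_sqrt.tendsto _).comp
        ((tendsto_const_nhds.sub (tendsto_const_nhds.mul h3)).add (h3.pow 2)))
        tendsto_one_div_add_atTop_nhds_zero_nat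
    rw [sub_zero] at hlim
    refine le_of_tendsto' hlim fun n => ?_
    set w : ℝ≥0 := v + 1 / ((n : ℝ≥0) + 1) with hw
    have h4 : v < w := lt_add_of_pos_right _ (by positivity)
    have h5 := hlt w v t s h4
    have h6 : dist (x w t) (x v t) ≤ 1 / ((n : ℝ) + 1) := by
      refine (hup w t v t).trans (le_of_eq ?_)
      rw [sub_self, hw]
      push_cast
      rw [show (0 : ℝ) ^ 2 - 2 * c * 0 * ((v : ℝ) + 1 / ((n : ℝ) + 1) - v) +
        ((v : ℝ) + 1 / ((n : ℝ) + 1) - v) ^ 2 = (1 / ((n : ℝ) + 1)) ^ 2 by ring,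
        Real.sqrt_sq (by positivity)]
    linarith [dist_triangle (x w t) (x v t) (x v s)]
  · rw [dist_comm]
    refine le_trans (le_of_eq ?_) (hlt v u s t huv)
    congr 1
    ring

/-- Closedness of the image comes from completeness of the half-plane, convexity from uniqueness of
geodesics. -/
theorem boundsFlatHalfPlane_of_isometry {σ : ℝ → Y} {ι : WithLp 2 (ℝ≥0 × ℝ) → Y} (hι : Isometry ι)
    (h : ∀ t, σ t = ι (WithLp.toLp 2 (0, t))) : BoundsFlatHalfPlane σ := by
  have hd : ∀ p q : WithLp 2 (ℝ≥0 × ℝ), dist p q =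
      √(((p.fst : ℝ) - q.fst) ^ 2 + (p.snd - q.snd) ^ 2) := by
    intro p q
    rw [WithLp.prod_dist_eq_add (by norm_num), Real.sqrt_eq_rpow, NNReal.dist_eq, Real.dist_eq]
    simp
  have : CompleteSpace (WithLp 2 (ℝ≥0 × ℝ)) := inferInstance
  refine ⟨ι, hι, hι.isClosedEmbedding.isClosed_range, ?_, h⟩
  rintro γ l hγ ⟨p, hp⟩ ⟨q, hq⟩ t ⟨t0, t1⟩
  rcases hγ.1.eq_or_lt with rfl | hl
  · obtain rfl : t = 0 := le_antisymm t1 t0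
    exact ⟨p, hp⟩
  have k0 : 0 ≤ t / l := by positivity
  have k1 : t / l ≤ 1 := (div_le_one hl).2 t1
  have hb := hγ.between k0 k1
  rw [div_mul_cancel₀ _ hl.ne'] at hb
  set k := t / l
  set m : WithLp 2 (ℝ≥0 × ℝ) := WithLp.toLp 2
    (⟨(1 - k) * p.fst + k * q.fst, by
      have := p.fst.2
      have := q.fst.2
      have : 0 ≤ 1 - k := by linarith
      positivity⟩, (1 - k) * p.snd + k * q.snd) with hm
  have hm1 : (m.fst : ℝ) = (1 - k) * p.fst + k * q.fst := rfl
  have hm2 : m.snd = (1 - k) * p.snd + k * q.snd := rfl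
  refine ⟨m, Between.unique ?_ hb k0 k1⟩
  rw [← hp, ← hq]
  refine ⟨?_, ?_⟩ <;> rw [hι.dist_eq, hι.dist_eq, hd, hd, hm1, hm2]
  · rw [show ((p.fst : ℝ) - ((1 - k) * p.fst + k * q.fst)) ^ 2 +
      (p.snd - ((1 - k) * p.snd + k * q.snd)) ^ 2 = k ^ 2 *
      (((p.fst : ℝ) - q.fst) ^ 2 + (p.snd - q.snd) ^ 2) by ring, Real.sqrt_mul (sq_nonneg _),
      Real.sqrt_sq k0]
  · rw [show (((1 - k) * p.fst + k * q.fst) - (q.fst : ℝ)) ^ 2 +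
      (((1 - k) * p.snd + k * q.snd) - q.snd) ^ 2 = (1 - k) ^ 2 *
      (((p.fst : ℝ) - q.fst) ^ 2 + (p.snd - q.snd) ^ 2) by ring, Real.sqrt_mul (sq_nonneg _),
      Real.sqrt_sq (by linarith)]

/-- A line bounds a flat half-plane if some Busemann function is affine on it, of slope less than
one in absolute value. -/
theorem boundsFlatHalfPlane_of_tendsto [ProperSpace Y] {σ : ℝ → Y} (hσ : Isometry σ) {y : ℕ → Y}
    {c : ℝ} (hc : c ^ 2 < 1) (h1 : Tendsto (fun n => dist (y n) (σ 0)) atTop atTop)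
    (h2 : ∀ t, Tendsto (fun n => dist (y n) (σ t) - dist (y n) (σ 0)) atTop (𝓝 (c * t))) :
    BoundsFlatHalfPlane σ := by
  obtain ⟨x, hx0, hx⟩ := exists_limit_sector hσ h1 h2
  have hd := dist_sector hσ hx0 hx
  have hq : 0 < √(1 - c ^ 2) := Real.sqrt_pos.2 (by linarith)
  have hq2 : √(1 - c ^ 2) ^ 2 = 1 - c ^ 2 := Real.sq_sqrt (by linarith)
  set q := √(1 - c ^ 2)
  -- Orthogonal coordinates: the sector metric is `((t - c * u) - (s - c * v)) ^ 2 + q ^ 2 * (u - v)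
  -- ^ 2`, so `(u, t)` has height `q * u` over the point `t - c * u` of the line.
  refine boundsFlatHalfPlane_of_isometry
    (ι := fun p => x (p.fst / q.toNNReal) (p.snd + c * (p.fst / q))) ?_ fun t => ?_
  · refine Isometry.of_dist_eq fun p p' => ?_
    rw [hd, WithLp.prod_dist_eq_add (by norm_num), NNReal.dist_eq, Real.dist_eq]
    simp only [NNReal.coe_div, Real.coe_toNNReal _ hq.le]
    rw [show (((2 : ENNReal).toReal)) = ((2 : ℕ) : ℝ) by norm_num, Real.rpow_natCast,
      Real.rpow_natCast, sq_abs, sq_abs, Real.sqrt_eq_rpow]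
    congr 1
    · have : (p.fst : ℝ) / q - p'.fst / q = ((p.fst : ℝ) - p'.fst) / q := by ring
      have h3 : ((p.fst : ℝ) - p'.fst) ^ 2 = (((p.fst : ℝ) - p'.fst) / q) ^ 2 * (1 - c ^ 2) := by
        rw [← hq2]; field_simp
      rw [h3]
      ring
  · change σ t = x (0 / q.toNNReal) (t + c * (((0 : ℝ≥0) : ℝ) / q))
    simp only [zero_div, NNReal.coe_zero, mul_zero, add_zero]
    exact (dist_eq_zero.1 (hx0 0 t)).symm

theorem BoundsFlatHalfPlane.of_neg {σ : ℝ → Y} (h : BoundsFlatHalfPlane fun t => σ (-t)) :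
    BoundsFlatHalfPlane σ := by
  obtain ⟨ι, hι, -, -, h⟩ := h
  refine boundsFlatHalfPlane_of_isometry
    (ι := fun p => ι (WithLp.toLp 2 (p.fst, -p.snd))) ?_ fun t => ?_
  · refine Isometry.of_dist_eq fun p p' => ?_
    rw [hι.dist_eq, WithLp.prod_dist_eq_add (by norm_num), WithLp.prod_dist_eq_add (by norm_num)]
    change (dist p.fst p'.fst ^ _ + dist (-p.snd) (-p'.snd) ^ _) ^ _ = _
    rw [dist_neg_neg]
  · have := h (-t)
    simp only [neg_neg] at this
    exact this

end HalfPlane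

/-! ### Feet on a geodesic line -/

section Feet

variable {Y : Type*} [MetricSpace Y]

/-- `σ p` is a point of `σ` that is nearest to `y`. -/
def Foot (σ : ℝ → Y) (y : Y) (p : ℝ) : Prop := ∀ t, dist y (σ p) ≤ dist y (σ t)

theorem exists_foot {σ : ℝ → Y} (hσ : Isometry σ) (y : Y) : ∃ p, Foot σ y p := by
  refine (continuous_const.dist hσ.continuous).exists_forall_le ?_
  have h1 : Tendsto (fun t : ℝ => ‖t‖ - dist y (σ 0)) (cocompact ℝ) atTop :=
    tendsto_atTop_add_const_right _ _ tendsto_norm_cocompact_atTop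
  refine tendsto_atTop_mono (fun t => ?_) h1
  have h2 := dist_triangle_left (σ t) (σ 0) y
  rw [hσ.dist_eq, Real.dist_eq, sub_zero] at h2
  rw [Real.norm_eq_abs]
  linarith

theorem Foot.neg {σ : ℝ → Y} {y : Y} {p : ℝ} (h : Foot σ y p) : Foot (fun t => σ (-t)) y (-p) := by
  intro t
  simp only [neg_neg]
  exact h _

theorem Foot.map {σ : ℝ → Y} {y : Y} {p : ℝ} (h : Foot σ y p) (g : Y ≃ᵢ Y) :
    Foot (fun t => g (σ t)) (g y) p := by
  intro t
  rw [g.isometry.dist_eq, g.isometry.dist_eq]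
  exact h t

theorem Foot.of_map {σ : ℝ → Y} {y : Y} {p : ℝ} {g : Y ≃ᵢ Y}
    (h : Foot (fun t => g (σ t)) (g y) p) : Foot σ y p := by
  intro t
  have := h t
  rwa [g.isometry.dist_eq, g.isometry.dist_eq] at this

theorem isometry_neg {σ : ℝ → Y} (hσ : Isometry σ) : Isometry fun t => σ (-t) :=
  hσ.comp (IsometryEquiv.neg ℝ).isometry

variable [CATZero Y]

theorem convexOn_dist_line {σ : ℝ → Y} (hσ : Isometry σ) (y : Y) :
    ConvexOn ℝ univ fun t => dist y (σ t) := by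
  refine ⟨convex_univ, fun a _ b _ s t hs ht hst => ?_⟩
  obtain rfl : s = 1 - t := by linarith
  have := (between_of_line hσ (a := a) (b := b) ht (by linarith)).dist_point_le ht (by linarith) y
  simp only [smul_eq_mul, dist_comm y]
  exact this

/-- Secant slopes of a convex function increase when both ends move to the right. This transports
slope bounds between distant parts of the axis. -/
theorem slope_dist_line_mono {σ : ℝ → Y} (hσ : Isometry σ) (y : Y) {a b u v : ℝ} (hab : a < b)
    (huv : u < v) (hau : a ≤ u) (hbv : b ≤ v) :
    (dist y (σ b) - dist y (σ a)) / (b - a) ≤ (dist y (σ v) - dist y (σ u)) / (v - u) := by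
  have hf := convexOn_dist_line hσ y
  have h1 := hf.secant_mono (mem_univ a) (mem_univ b) (mem_univ v) hab.ne' (hab.trans_le hbv).ne' hbv
  have h2 := hf.secant_mono (mem_univ v) (mem_univ a) (mem_univ u) (hab.trans_le hbv).ne huv.ne hau
  rw [← neg_div_neg_eq, neg_sub, neg_sub, ← neg_div_neg_eq (_ - _) (u - v), neg_sub, neg_sub] at h2
  exact h1.trans h2

end Feet

/-! ### Translations along an axis -/

section Axis

variable {Y : Type*} [MetricSpace Y]

theorem zpow_apply_axis {h : Y ≃ᵢ Y} {σ : ℝ → Y} {l : ℝ} (hl : ∀ t, h (σ t) = σ (t + l)) (k : ℤ)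
    (t : ℝ) : (h ^ k) (σ t) = σ (t + k * l) := by
  induction k using Int.induction_on generalizing t with
  | zero => simp
  | succ k ih =>
    rw [zpow_add_one, IsometryEquiv.mul_apply, hl, ih]
    congr 1; push_cast; ring
  | pred k ih =>
    have h1 : h⁻¹ (σ t) = σ (t - l) := by
      have := hl (t - l)
      rw [sub_add_cancel] at this
      rw [← this, IsometryEquiv.inv_apply_self]
    rw [zpow_sub_one, IsometryEquiv.mul_apply, h1, ih]
    congr 1; push_cast; ring

theorem dist_zpow_axis {h : Y ≃ᵢ Y} {σ : ℝ → Y} {l : ℝ} (hl : ∀ t, h (σ t) = σ (t + l)) (k : ℤ)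
    (y : Y) (t : ℝ) : dist ((h ^ k) y) (σ t) = dist y (σ (t - k * l)) := by
  have := zpow_apply_axis hl k (t - k * l)
  rw [sub_add_cancel] at this
  rw [← this, (h ^ k).isometry.dist_eq]

theorem Foot.zpow_axis {h : Y ≃ᵢ Y} {σ : ℝ → Y} {l : ℝ} (hl : ∀ t, h (σ t) = σ (t + l)) {y : Y}
    {p : ℝ} (hp : Foot σ y p) (k : ℤ) : Foot σ ((h ^ k) y) (p + k * l) := by
  intro t
  rw [dist_zpow_axis hl, dist_zpow_axis hl, add_sub_cancel_right]
  exact hp _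

theorem inv_apply_axis {h : Y ≃ᵢ Y} {σ : ℝ → Y} {l : ℝ} (hl : ∀ t, h (σ t) = σ (t + l)) (t : ℝ) :
    h⁻¹ (σ (-t)) = σ (-(t + l)) := by
  have := zpow_apply_axis hl (-1) (-t)
  rw [zpow_neg_one] at this
  rw [this]
  congr 1; push_cast; ring

/-- The function `t ↦ d(y, σ t)` of some point `y` far away has all its slopes in `[0, c]` on a long
interval around the origin. -/
def HasSlopesUpTo (σ : ℝ → Y) (c N : ℝ) : Prop :=
  ∃ y, N ≤ dist y (σ 0) ∧ ∀ a b, -N ≤ a → a ≤ b → b ≤ N →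
    0 ≤ dist y (σ b) - dist y (σ a) ∧ dist y (σ b) - dist y (σ a) ≤ c * (b - a)

theorem HasSlopesUpTo.mono {σ : ℝ → Y} {c N M : ℝ} (h : HasSlopesUpTo σ c N) (hM : M ≤ N) :
    HasSlopesUpTo σ c M := by
  obtain ⟨y, h1, h2⟩ := h
  exact ⟨y, hM.trans h1, fun a b ha hab hb => h2 a b (by linarith) hab (by linarith)⟩

variable [CATZero Y]

/-- Here `c` will be the least admissible slope. A point with slopes at most `c₁` on a very long
interval must exceed `c₂` on every window of length `2 * N`, since the window can be translated to
the origin. Taking a window to the left of `[-n, n]`, convexity pinches the slopes on `[-n, n]`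
between `c₂` and `c₁`. -/
theorem exists_almost_constant_slope {h : Y ≃ᵢ Y} {σ : ℝ → Y} (hσ : Isometry σ) {l : ℝ}
    (l0 : 0 < l) (hl : ∀ t, h (σ t) = σ (t + l)) {c c₁ c₂ : ℝ} (h1 : ∀ N, HasSlopesUpTo σ c₁ N)
    (h2 : ¬ ∀ N, HasSlopesUpTo σ c₂ N) {ε : ℝ} (hc1 : c₁ ≤ c + ε) (hc2 : c - ε ≤ c₂) {n : ℝ}
    (hn : 0 ≤ n) : ∃ y, n ≤ dist y (σ 0) ∧ ∀ u v, -n ≤ u → u ≤ v → v ≤ n →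
      |dist y (σ v) - dist y (σ u) - c * (v - u)| ≤ ε * (v - u) := by
  push Not at h2
  obtain ⟨N₀, hN₀⟩ := h2
  set N := max N₀ 0 with hN
  have hN0 : 0 ≤ N := le_max_right _ _
  replace hN₀ : ¬ HasSlopesUpTo σ c₂ N := fun hh => hN₀ (hh.mono (le_max_left _ _))
  obtain ⟨y, hy1, hy2⟩ := h1 (2 * (2 * N + n + l))
  -- Pulling back by `k * l ≥ N + n` moves the window `[-N, N]` to the left of `-n`.
  set k : ℤ := ⌈(N + n) / l⌉ with hk
  have hk1 : N + n ≤ k * l := by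
    have := Int.le_ceil ((N + n) / l)
    rwa [div_le_iff₀ l0] at this
  have hk2 : k * l ≤ N + n + l := by
    have := (Int.ceil_lt_add_one ((N + n) / l)).le
    rw [← hk] at this
    have h3 := mul_le_mul_of_nonneg_right this l0.le
    rwa [add_mul, div_mul_cancel₀ _ l0.ne', one_mul] at h3
  have hfar : N ≤ dist ((h ^ k) y) (σ 0) := by
    rw [dist_zpow_axis hl, zero_sub]
    have := dist_triangle y (σ (-(k * l))) (σ 0)
    rw [hσ.dist_eq, Real.dist_eq, sub_zero, abs_neg, abs_of_nonneg (by linarith)] at this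
    linarith
  have hex : ∃ a b, -N ≤ a ∧ a ≤ b ∧ b ≤ N ∧
      c₂ * (b - a) < dist ((h ^ k) y) (σ b) - dist ((h ^ k) y) (σ a) := by
    by_contra! hcon
    refine hN₀ ⟨(h ^ k) y, hfar, fun a b ha hab hb => ⟨?_, hcon a b ha hab hb⟩⟩
    rw [dist_zpow_axis hl, dist_zpow_axis hl]
    exact (hy2 _ _ (by linarith) (by linarith) (by linarith)).1
  obtain ⟨a, b, ha, hab, hb, hlt⟩ := hex
  rw [dist_zpow_axis hl, dist_zpow_axis hl] at hlt
  have hab' : a < b := by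
    rcases hab.eq_or_lt with rfl | h
    · simp at hlt
    · exact h
  refine ⟨y, by linarith, fun u v hu huv hv => ?_⟩
  rcases huv.eq_or_lt with rfl | huv'
  · simp
  have hup := (hy2 u v (by linarith) huv (by linarith)).2
  have hs := slope_dist_line_mono hσ y (a := a - k * l) (b := b - k * l) (by linarith) huv'
    (by linarith) (by linarith)
  rw [le_div_iff₀ (by linarith), sub_sub_sub_cancel_right] at hs
  have hlow : c₂ ≤ (dist y (σ (b - k * l)) - dist y (σ (a - k * l))) / (b - a) := by
    rw [le_div_iff₀ (by linarith)]; exact hlt.le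
  have hvu : 0 ≤ v - u := by linarith
  have h5 := (mul_le_mul_of_nonneg_right (hc2.trans hlow) hvu).trans hs
  have h6 := hup.trans (mul_le_mul_of_nonneg_right hc1 hvu)
  rw [abs_le]
  constructor <;> linarith

/-- The infimum of the admissible slopes cannot be lowered, so on growing intervals the distance
functions become affine with exactly this slope, which is at most `c₀` and hence less than one. -/
theorem boundsFlatHalfPlane_of_hasSlopesUpTo [ProperSpace Y] {h : Y ≃ᵢ Y} {σ : ℝ → Y}
    (hσ : Isometry σ) {l : ℝ} (l0 : 0 < l) (hl : ∀ t, h (σ t) = σ (t + l)) {c₀ : ℝ} (hc₀ : c₀ < 1)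
    (hS : ∀ N, HasSlopesUpTo σ c₀ N) : BoundsFlatHalfPlane σ := by
  set A : Set ℝ := {c | ∀ N, HasSlopesUpTo σ c N}
  have hA0 : ∀ c ∈ A, 0 ≤ c := by
    intro c hc
    obtain ⟨y, -, h2⟩ := hc 1
    have := h2 0 1 (by norm_num) (by norm_num) le_rfl
    linarith [this.1, this.2]
  have hbdd : BddBelow A := ⟨0, hA0⟩
  set c := sInf A
  have hc0 : 0 ≤ c := le_csInf ⟨c₀, hS⟩ hA0
  have hc1 : c ≤ c₀ := csInf_le hbdd hS
  have key : ∀ n : ℕ, ∃ y, (n : ℝ) ≤ dist y (σ 0) ∧ ∀ u v, -(n : ℝ) ≤ u → u ≤ v → v ≤ n →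
      |dist y (σ v) - dist y (σ u) - c * (v - u)| ≤ 1 / ((n : ℝ) + 1) * (v - u) := by
    intro n
    have hε : 0 < 1 / ((n : ℝ) + 1) := by positivity
    obtain ⟨c₁, hc₁, hlt⟩ := exists_lt_of_csInf_lt (s := A) ⟨c₀, hS⟩ (lt_add_of_pos_right c hε)
    have hc₂ : ¬ ∀ N, HasSlopesUpTo σ (c - 1 / ((n : ℝ) + 1)) N := fun hh => by
      have := csInf_le hbdd (show c - 1 / ((n : ℝ) + 1) ∈ A from hh)
      linarith
    exact exists_almost_constant_slope hσ l0 hl hc₁ hc₂ hlt.le le_rfl n.cast_nonneg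
  choose y hy1 hy2 using key
  refine boundsFlatHalfPlane_of_tendsto hσ (y := y) (c := c) (by nlinarith)
    (tendsto_atTop_mono hy1 tendsto_natCast_atTop_atTop) fun t => ?_
  have hz : Tendsto (fun n : ℕ => 1 / ((n : ℝ) + 1) * |t|) atTop (𝓝 0) := by
    have := (tendsto_one_div_add_atTop_nhds_zero_nat (𝕜 := ℝ)).mul_const |t|
    rwa [zero_mul] at this
  rw [tendsto_iff_dist_tendsto_zero]
  refine squeeze_zero' (Eventually.of_forall fun _ => dist_nonneg) ?_ hz
  filter_upwards [tendsto_natCast_atTop_atTop.eventually_ge_atTop |t|] with n hn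
  rw [Real.dist_eq]
  obtain ⟨hn1, hn2⟩ := abs_le.1 hn
  rcases le_total 0 t with ht | ht
  · have := hy2 n 0 t (by linarith) ht hn2
    rw [abs_of_nonneg ht]
    rwa [sub_zero] at this
  · have := hy2 n t 0 hn1 ht (by linarith)
    rw [abs_of_nonpos ht, abs_sub_comm]
    rw [zero_sub] at this
    convert this using 2
    ring

/-- Seen from a point, the part of a rank one axis far from the foot of the point is almost
radial. -/
theorem exists_radial_of_not_boundsFlatHalfPlane [ProperSpace Y] {h : Y ≃ᵢ Y} {σ : ℝ → Y}
    (hσ : Isometry σ) {l : ℝ} (l0 : 0 < l) (hl : ∀ t, h (σ t) = σ (t + l))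
    (hF : ¬ BoundsFlatHalfPlane σ) {c₀ : ℝ} (hc₀ : c₀ < 1) :
    ∃ T, ∀ y p, Foot σ y p → ∀ t₁ t₂, p + T ≤ t₁ → t₁ ≤ t₂ →
      c₀ * (t₂ - t₁) ≤ dist y (σ t₂) - dist y (σ t₁) := by
  by_contra! hcon
  refine hF (boundsFlatHalfPlane_of_hasSlopesUpTo hσ l0 hl hc₀ fun N₀ => ?_)
  refine HasSlopesUpTo.mono (N := max N₀ 0) ?_ (le_max_left _ _)
  set N := max N₀ 0
  have hN : 0 ≤ N := le_max_right _ _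
  have hT0 : 0 ≤ 2 * N / (1 - c₀) := div_nonneg (by linarith) (by linarith)
  -- The first summand leaves room for a window of radius `N` between `p` and `t₁`, after rounding
  -- its centre to a multiple of `l`. The second keeps `y` at distance at least `N` from the line,
  -- since `dist y (σ t)` grows with average slope at most `c₀ < 1` on `[p, t₁]`.
  set T := 2 * (N + l) + 2 * N / (1 - c₀) with hT
  obtain ⟨y, p, hp, t₁, t₂, h1, h2, h3⟩ := hcon T
  have h2' : t₁ < t₂ := by
    rcases h2.eq_or_lt with rfl | h
    · simp at h3
    · exact h
  have h3' : (dist y (σ t₂) - dist y (σ t₁)) / (t₂ - t₁) ≤ c₀ := by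
    rw [div_le_iff₀ (by linarith)]; exact h3.le
  have hpt : p < t₁ := by linarith
  -- The window is centred about halfway between the foot, to the right of which slopes are
  -- nonnegative, and `p + T ≤ t₁`, to the left of which they are at most `c₀`.
  set k : ℤ := ⌊(p + T / 2) / l⌋ with hk
  have hk1 : k * l ≤ p + T / 2 := by
    have := Int.floor_le ((p + T / 2) / l)
    rwa [le_div_iff₀ l0] at this
  have hk2 : p + T / 2 ≤ k * l + l := by
    have := (Int.lt_floor_add_one ((p + T / 2) / l)).le
    rw [← hk, div_le_iff₀ l0] at this
    linarith
  have hd : ∀ t, dist ((h ^ (-k)) y) (σ t) = dist y (σ (t + k * l)) := by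
    intro t
    rw [dist_zpow_axis hl]
    congr 2; push_cast; ring
  refine ⟨(h ^ (-k)) y, ?_, fun a b ha hab hb => ?_⟩
  · rw [hd]
    refine le_trans ?_ (hp _)
    have h4 := (slope_dist_line_mono hσ y hpt h2' hpt.le h2).trans h3'
    rw [div_le_iff₀ (by linarith)] at h4
    have h5 := dist_triangle_left (σ t₁) (σ p) y
    rw [hσ.dist_eq, Real.dist_eq, abs_of_pos (by linarith)] at h5
    have h6 : 2 * N ≤ (1 - c₀) * (t₁ - p) := by
      have : 2 * N = (1 - c₀) * (2 * N / (1 - c₀)) := by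
        have : 1 - c₀ ≠ 0 := by linarith
        field_simp
      rw [this]
      exact mul_le_mul_of_nonneg_left (by linarith) (by linarith)
    linarith
  · rw [hd, hd]
    rcases hab.eq_or_lt with rfl | hab'
    · simp
    have h4 := slope_dist_line_mono hσ y (a := p) (b := b + k * l) (u := a + k * l)
      (v := b + k * l) (by linarith) (by linarith) (by linarith) le_rfl
    have h5 := (slope_dist_line_mono hσ y (a := a + k * l) (b := b + k * l) (by linarith) h2'
      (by linarith) (by linarith)).trans h3'
    have h6 := (div_nonneg (sub_nonneg.2 (hp (b + k * l))) (by linarith)).trans h4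
    rw [add_sub_add_right_eq_sub] at h5 h6
    rw [div_le_iff₀ (by linarith)] at h5
    refine ⟨?_, h5⟩
    by_contra! hneg
    exact absurd h6 (not_le.2 (div_neg_of_neg_of_pos hneg (by linarith)))

end Axis

/-! ### Contracting lines -/

section Contracting

variable {Y : Type*} [MetricSpace Y]

/-- A geodesic line is contracting if the geodesics between points with distant feet pass close
to the points between the feet. -/
def IsContracting (σ : ℝ → Y) (B : ℝ) : Prop :=
  ∀ y z p q t, Foot σ y p → Foot σ z q → p + B ≤ t → t + B ≤ q →
    ∀ (c : ℝ → Y) (L : ℝ), IsGeodesicPath c L → c 0 = y → c L = z →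
      ∃ u ∈ Icc 0 L, dist (c u) (σ t) ≤ B

theorem IsContracting.map {σ : ℝ → Y} {B : ℝ} (h : IsContracting σ B) (g : Y ≃ᵢ Y) :
    IsContracting (fun t => g (σ t)) B := by
  intro y z p q t hp hq h1 h2 c L hc cy cz
  have hp' : Foot σ (g.symm y) p := Foot.of_map (g := g) (by rwa [g.apply_symm_apply])
  have hq' : Foot σ (g.symm z) q := Foot.of_map (g := g) (by rwa [g.apply_symm_apply])
  obtain ⟨u, hu, hd⟩ := h _ _ p q t hp' hq' h1 h2 _ L (hc.map g.symm.isometry) (by rw [cy])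
    (by rw [cz])
  refine ⟨u, hu, ?_⟩
  rwa [← g.isometry.dist_eq, g.apply_symm_apply] at hd

theorem IsContracting.neg {σ : ℝ → Y} {B : ℝ} (h : IsContracting σ B) :
    IsContracting (fun t => σ (-t)) B := by
  intro y z p q t hp hq h1 h2 c L hc cy cz
  have hp' := hp.neg
  have hq' := hq.neg
  simp only [neg_neg] at hp' hq'
  obtain ⟨u, hu, hd⟩ := h z y (-q) (-p) (-t) hq' hp' (by linarith) (by linarith) _ L hc.reverse
    (by simpa using cz) (by simpa using cy)
  exact ⟨L - u, ⟨by linarith [hu.2], by linarith [hu.1]⟩, hd⟩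

variable [CATZero Y]

/-- The points at distance `u` from `σ s` towards `q` and `z` lie within `u / 8` of `σ (s - u)` and
`σ (s + u)`, hence at least `7 / 4 * u` apart. So the comparison angle at `σ s` has cosine at most
`-17 / 32`; being below `-1 / 2` is what the conclusion needs. -/
theorem dist_add_half_le {σ : ℝ → Y} (hσ : Isometry σ) {q z : Y} {s u : ℝ} (hu : 0 < u)
    (hq1 : u ≤ dist q (σ s)) (hz1 : u ≤ dist z (σ s))
    (hq : dist q (σ (s - u)) ≤ dist q (σ s) - 127 / 128 * u)
    (hz : dist z (σ (s + u)) ≤ dist z (σ s) - 127 / 128 * u) :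
    dist z (σ s) + dist q (σ s) / 2 ≤ dist q z := by
  have main : ∀ (w : Y) (v : ℝ), dist (σ s) (σ v) = u → u ≤ dist w (σ s) →
      dist w (σ v) ≤ dist w (σ s) - 127 / 128 * u →
      ∃ m, Between (u / dist (σ s) w) (σ s) w m ∧ dist m (σ v) ≤ u / 8 := by
    intro w v hv hw hle
    rw [dist_comm w (σ s)] at hw hle
    have hA : 0 < dist (σ s) w := hu.trans_le hw
    have k0 : 0 ≤ u / dist (σ s) w := by positivity
    have k1 : u / dist (σ s) w ≤ 1 := (div_le_one hA).2 hw
    obtain ⟨m, hm⟩ := exists_between (σ s) w k0 k1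
    refine ⟨m, hm, ?_⟩
    have h1 := hm.stewart k0 k1 (σ v)
    rw [hv] at h1
    set A := dist (σ s) w
    have h2 : dist w (σ v) ^ 2 ≤ (A - 127 / 128 * u) ^ 2 := pow_le_pow_left₀ dist_nonneg hle 2
    have h3 := mul_le_mul_of_nonneg_left h2 k0
    set k := u / A
    have hkA : k * A = u := div_mul_cancel₀ _ hA.ne'
    refine (abs_le_of_sq_le_sq' (h1.trans ?_) (by positivity)).2
    have e1 : k * (A - 127 / 128 * u) ^ 2 = u * A - 127 / 64 * u * u + k * (127 / 128 * u) ^ 2 := by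
      rw [← hkA]; ring
    have e2 : k * (1 - k) * A ^ 2 = u * A - u ^ 2 := by
      rw [← hkA]; ring
    have e3 : 0 ≤ k * u ^ 2 := by positivity
    nlinarith
  obtain ⟨m, hm, hmd⟩ := main q (s - u) (by
    rw [hσ.dist_eq, Real.dist_eq, sub_sub_cancel, abs_of_pos hu]) hq1 hq
  obtain ⟨n, hn, hnd⟩ := main z (s + u) (by
    rw [hσ.dist_eq, Real.dist_eq, sub_add_cancel_left, abs_neg, abs_of_pos hu]) hz1 hz
  have h4 := dist_triangle4 (σ (s - u)) m n (σ (s + u))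
  rw [hσ.dist_eq, Real.dist_eq, dist_comm _ m, show s - u - (s + u) = -(2 * u) by ring, abs_neg,
    abs_of_pos (by linarith)] at h4
  have h5 : 7 / 4 * u ≤ dist m n := by linarith
  rw [dist_comm q (σ s)] at hq1 ⊢
  rw [dist_comm z (σ s)] at hz1 ⊢
  have hA : 0 < dist (σ s) q := hu.trans_le hq1
  have hC : 0 < dist (σ s) z := hu.trans_le hz1
  have h6 := hm.cat hn (by positivity) ((div_le_one hA).2 hq1) (by positivity)
    ((div_le_one hC).2 hz1)
  set A := dist (σ s) q
  set C := dist (σ s) z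
  have h7 : (7 / 4 * u) ^ 2 ≤ dist m n ^ 2 := pow_le_pow_left₀ (by positivity) h5 2
  have h8 : (u / A) ^ 2 * A ^ 2 + (u / C) ^ 2 * C ^ 2 -
      u / A * (u / C) * (A ^ 2 + C ^ 2 - dist q z ^ 2) =
      u ^ 2 * (2 - (A ^ 2 + C ^ 2 - dist q z ^ 2) / (A * C)) := by
    field_simp
    ring
  rw [h8] at h6
  have h9 : u ^ 2 * (49 / 16) ≤ u ^ 2 * (2 - (A ^ 2 + C ^ 2 - dist q z ^ 2) / (A * C)) := by
    linarith
  have h10 := le_of_mul_le_mul_left h9 (by positivity)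
  have h11 : (A ^ 2 + C ^ 2 - dist q z ^ 2) / (A * C) ≤ -17 / 16 := by linarith
  rw [div_le_iff₀ (by positivity)] at h11
  refine (abs_le_of_sq_le_sq' ?_ dist_nonneg).2
  nlinarith [mul_pos hA hC]

/-- An intermediate value argument. The points for which `σ t` is nearest among parameters to the
right of `t`, or among those to the left, form two closed sets. By convexity they cover the
geodesic, and each contains an end, so they meet on it. -/
theorem exists_foot_eq {σ : ℝ → Y} (hσ : Isometry σ) {y z : Y} {p q t : ℝ} (hp : Foot σ y p)
    (hq : Foot σ z q) (hpt : p ≤ t) (htq : t ≤ q) {c : ℝ → Y} {L : ℝ} (hc : IsGeodesicPath c L)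
    (cy : c 0 = y) (cz : c L = z) : ∃ u ∈ Icc 0 L, Foot σ (c u) t := by
  have away : ∀ (w : Y) (r a b : ℝ), Foot σ w r → r ≤ a → a ≤ b → dist w (σ a) ≤ dist w (σ b) := by
    intro w r a b hr hra hab
    rcases hab.eq_or_lt with rfl | hab
    · exact le_rfl
    have h1 := slope_dist_line_mono hσ w (a := r) (b := b) (u := a) (v := b) (by linarith) hab hra
      le_rfl
    have h2 := (div_nonneg (sub_nonneg.2 (hr b)) (by linarith)).trans h1
    by_contra! hneg
    exact absurd h2 (not_le.2 (div_neg_of_neg_of_pos (by linarith) (by linarith)))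
  have toward : ∀ (w : Y) (r a b : ℝ), Foot σ w r → b ≤ r → a ≤ b →
      dist w (σ b) ≤ dist w (σ a) := by
    intro w r a b hr hrb hab
    rcases hab.eq_or_lt with rfl | hab
    · exact le_rfl
    have h1 := slope_dist_line_mono hσ w (a := a) (b := b) (u := a) (v := r) hab (by linarith)
      le_rfl hrb
    have h2 := h1.trans (div_nonpos_of_nonpos_of_nonneg (sub_nonpos.2 (hr a)) (by linarith))
    by_contra! hpos
    exact absurd h2 (not_le.2 (div_pos (by linarith) (by linarith)))
  set S : Set Y := {w | ∀ t', t ≤ t' → dist w (σ t) ≤ dist w (σ t')}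
  set S' : Set Y := {w | ∀ t', t' ≤ t → dist w (σ t) ≤ dist w (σ t')}
  have hS : IsClosed S := by
    simp only [S, ofPred_forall]
    exact isClosed_iInter fun t' => isClosed_iInter fun _ =>
      isClosed_le (continuous_id.dist continuous_const) (continuous_id.dist continuous_const)
  have hS' : IsClosed S' := by
    simp only [S', ofPred_forall]
    exact isClosed_iInter fun t' => isClosed_iInter fun _ =>
      isClosed_le (continuous_id.dist continuous_const) (continuous_id.dist continuous_const)
  have hcont : ContinuousOn c (Icc 0 L) := by
    have : LipschitzOnWith 1 c (Icc 0 L) := LipschitzOnWith.of_dist_le_mul fun s hs t ht => by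
      rw [hc.2 s hs t ht, Real.dist_eq, NNReal.coe_one, one_mul]
    exact this.continuousOn
  have hpre : IsPreconnected (c '' Icc 0 L) := isPreconnected_Icc.image c hcont
  have m0 : c 0 ∈ c '' Icc 0 L := mem_image_of_mem _ ⟨le_rfl, hc.1⟩
  have mL : c L ∈ c '' Icc 0 L := mem_image_of_mem _ ⟨hc.1, le_rfl⟩
  obtain ⟨-, ⟨u, hu, rfl⟩, h1, h2⟩ := isPreconnected_closed_iff.1 hpre S S' hS hS'
    (fun w _ => by
      obtain ⟨r, hr⟩ := exists_foot hσ w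
      rcases le_total r t with h | h
      · exact Or.inl fun t' ht' => away w r t t' hr h ht'
      · exact Or.inr fun t' ht' => toward w r t' t hr h ht')
    ⟨_, m0, fun t' ht' => away _ p t t' (cy ▸ hp) hpt ht'⟩
    ⟨_, mL, fun t' ht' => toward _ q t' t (cz ▸ hq) htq ht'⟩
  exact ⟨u, hu, fun t' => (le_total t t').elim (h1 t') (h2 t')⟩

/-- Axes of rank one isometries are contracting. -/
theorem exists_isContracting [ProperSpace Y] {h : Y ≃ᵢ Y} {σ : ℝ → Y}
    (hσ : IsAxis h σ) (hF : ¬ BoundsFlatHalfPlane σ) : ∃ B, 0 ≤ B ∧ IsContracting σ B := by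
  obtain ⟨hi, l, l0, hl⟩ := hσ
  obtain ⟨T₁, hT₁⟩ := exists_radial_of_not_boundsFlatHalfPlane hi l0 hl hF
    (c₀ := 127 / 128) (by norm_num)
  obtain ⟨T₂, hT₂⟩ := exists_radial_of_not_boundsFlatHalfPlane (isometry_neg hi) l0
    (inv_apply_axis hl) (fun hh => hF hh.of_neg) (c₀ := 127 / 128) (by norm_num)
  set T := max (max T₁ T₂) 0 with hT
  have e1 : T₁ ≤ T := (le_max_left _ _).trans (le_max_left _ _)
  have e2 : T₂ ≤ T := (le_max_right _ _).trans (le_max_left _ _)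
  have e3 : 0 ≤ T := le_max_right _ _
  have up : ∀ y p, Foot σ y p → ∀ s t, p + T ≤ s → s ≤ t →
      127 / 128 * (t - s) ≤ dist y (σ t) - dist y (σ s) := fun y p hp s t h1 h2 =>
    hT₁ y p hp s t (by linarith) h2
  have down : ∀ y p, Foot σ y p → ∀ s t, t + T ≤ p → s ≤ t →
      127 / 128 * (t - s) ≤ dist y (σ s) - dist y (σ t) := by
    intro y p hp s t h1 h2
    have := hT₂ y (-p) hp.neg (-t) (-s) (by linarith) (by linarith)
    simp only [neg_neg] at this
    linarith
  -- Let `w` be the point of the geodesic with foot `t`. From both sides `σ (t ± (T + 1))` is seen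
  -- almost radially, so a detour through `w` costs half its distances to these two points. As `w`
  -- lies on the geodesic, the cost is at most `2 * T + 2`; averaging the two triangle inequalities
  -- to `σ t` gives `3 * T + 3`.
  refine ⟨3 * T + 3, by linarith, fun y z p q t hp hq h1 h2 c L hc cy cz => ?_⟩
  obtain ⟨u, hu, hw⟩ := exists_foot_eq hi (t := t) hp hq (by linarith) (by linarith) hc cy cz
  refine ⟨u, hu, ?_⟩
  set w := c u with hwdef
  have pos : ∀ (x : Y) (s : ℝ), 0 ≤ dist x (σ s) := fun _ _ => dist_nonneg
  have a1 := up w t hw (t + T) (t + (T + 1)) le_rfl (by linarith)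
  have a2 := up w t hw (t + (T + 1) - 1 / 2) (t + (T + 1)) (by linarith) (by linarith)
  have a3 := down z q hq (t + (T + 1)) (t + (T + 1) + 1 / 2) (by linarith) (by linarith)
  have a4 := down w t hw (t - (T + 1)) (t - T) (by linarith) (by linarith)
  have a5 := down w t hw (t - (T + 1)) (t - (T + 1) + 1 / 2) (by linarith) (by linarith)
  have a6 := up y p hp (t - (T + 1) - 1 / 2) (t - (T + 1)) (by linarith) (by linarith)
  have a7 := down z q hq (t + (T + 1)) (t + (T + 1) + 1) (by linarith) (by linarith)
  have a8 := up y p hp (t - (T + 1) - 1) (t - (T + 1)) (by linarith) (by linarith)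
  have b1 := dist_add_half_le hi (q := w) (z := z) (s := t + (T + 1)) (u := 1 / 2) (by norm_num)
    (by linarith [pos w (t + T)]) (by linarith [pos z (t + (T + 1) + 1)])
    (by linarith) (by linarith)
  have b2 := dist_add_half_le (isometry_neg hi) (q := w) (z := y) (s := -(t - (T + 1)))
    (u := 1 / 2) (by norm_num)
    (by rw [neg_neg]; linarith [pos w (t - T)])
    (by rw [neg_neg]; linarith [pos y (t - (T + 1) - 1)])
    (by rw [neg_neg, show -(-(t - (T + 1)) - 1 / 2) = t - (T + 1) + 1 / 2 by ring]; linarith)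
    (by rw [neg_neg, show -(-(t - (T + 1)) + 1 / 2) = t - (T + 1) - 1 / 2 by ring]; linarith)
  rw [neg_neg] at b2
  have b3 : dist y w + dist w z = dist y z := by
    rw [hwdef, ← cy, ← cz, hc.dist_zero hu.1 hu.2, hc.dist_zero hc.1 le_rfl,
      hc.2 u hu L ⟨hc.1, le_rfl⟩, abs_sub_comm, abs_of_nonneg (by linarith [hu.2])]
    ring
  have b4 := dist_triangle4 y (σ (t - (T + 1))) (σ (t + (T + 1))) z
  rw [hi.dist_eq, Real.dist_eq, show t - (T + 1) - (t + (T + 1)) = -(2 * T + 2) by ring, abs_neg,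
    abs_of_nonneg (by linarith), dist_comm (σ (t + (T + 1))) z] at b4
  rw [dist_comm w y] at b2
  have b5 := dist_triangle w (σ (t + (T + 1))) (σ t)
  have b6 := dist_triangle w (σ (t - (T + 1))) (σ t)
  rw [hi.dist_eq, Real.dist_eq, add_sub_cancel_left, abs_of_nonneg (by linarith)] at b5
  rw [hi.dist_eq, Real.dist_eq, sub_sub_cancel_left, abs_neg, abs_of_nonneg (by linarith)] at b6
  linarith

end Contracting

/-! ### Independent rank one isometries -/

section Independent

variable {Y : Type*} [MetricSpace Y]

/-- Contracting lines that are followed by common geodesics are asymptotic. -/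
theorem exists_dist_le_of_common_geodesics {σ σ' : ℝ → Y} (hσ : Isometry σ) (hσ' : Isometry σ')
    {B B' : ℝ} (hB : 0 ≤ B) (hB' : 0 ≤ B') (hc : IsContracting σ B) (hc' : IsContracting σ' B')
    (o : Y) (H : ∀ M : ℝ, ∃ (c : ℝ → Y) (L u u' p p' : ℝ), IsGeodesicPath c L ∧ c 0 = o ∧
      u ∈ Icc 0 L ∧ u' ∈ Icc 0 L ∧ Foot σ (c u) p ∧ M ≤ p ∧ Foot σ' (c u') p' ∧ M ≤ p') :
    ∃ C, ∀ s, 0 ≤ s → dist (σ s) (σ' s) ≤ C := by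
  obtain ⟨a, ha⟩ := exists_foot hσ o
  obtain ⟨a', ha'⟩ := exists_foot hσ' o
  set s₀ := max (max (a + B) (a' + B')) 0
  have h1 : a + B ≤ s₀ := (le_max_left _ _).trans (le_max_left _ _)
  have h2 : a' + B' ≤ s₀ := (le_max_right _ _).trans (le_max_left _ _)
  have h3 : 0 ≤ s₀ := le_max_right _ _
  refine ⟨2 * B + 2 * B' + dist o (σ 0) + dist o (σ' 0) + 2 * s₀ + dist (σ 0) (σ' 0),
    fun s hs => ?_⟩
  have d1 : 0 ≤ dist o (σ 0) := dist_nonneg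
  have d2 : 0 ≤ dist o (σ' 0) := dist_nonneg
  have d3 : 0 ≤ dist (σ 0) (σ' 0) := dist_nonneg
  rcases le_total s s₀ with hss | hss
  · have h4 := dist_triangle4 (σ s) (σ 0) (σ' 0) (σ' s)
    rw [hσ.dist_eq, hσ'.dist_eq, Real.dist_eq, Real.dist_eq, sub_zero, zero_sub, abs_neg,
      abs_of_nonneg hs] at h4
    linarith
  -- A contracting line is near the common geodesic at almost the same parameter, because both
  -- parameters measure the distance from a fixed point up to a constant.
  have near : ∀ (ρ : ℝ → Y) (b D : ℝ), Isometry ρ → IsContracting ρ D → 0 ≤ D → Foot ρ o b →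
      b + D ≤ s → ∀ (c : ℝ → Y) (L u p : ℝ), IsGeodesicPath c L → c 0 = o → u ∈ Icc 0 L →
      Foot ρ (c u) p → s + D ≤ p → ∃ v ∈ Icc 0 L, dist (c v) (ρ s) ≤ D ∧
        |v - s| ≤ D + dist o (ρ 0) := by
    intro ρ b D hρ hcρ hD hb hbs c L u p hcL c0 hu hp hsp
    obtain ⟨v, hv, hd⟩ := hcρ o (c u) b p s hb hp hbs hsp c u (hcL.mono hu.1 hu.2) c0 rfl
    have hv' : v ∈ Icc 0 L := ⟨hv.1, hv.2.trans hu.2⟩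
    refine ⟨v, hv', hd, ?_⟩
    have e1 := hcL.dist_zero hv'.1 hv'.2
    rw [c0] at e1
    have e2 : dist (ρ 0) (ρ s) = s := by
      rw [hρ.dist_eq, Real.dist_eq, zero_sub, abs_neg, abs_of_nonneg hs]
    have e3 := dist_triangle o (c v) (ρ s)
    have e4 := dist_triangle_right o (c v) (ρ s)
    have e5 := dist_triangle_left (ρ 0) (ρ s) o
    have e6 := dist_triangle o (ρ 0) (ρ s)
    rw [abs_le]
    constructor <;> linarith
  obtain ⟨c, L, u, u', p, p', hcL, c0, hu, hu', hp, hM, hp', hM'⟩ := H (s + B + B')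
  obtain ⟨v, hv, e1, e2⟩ := near σ a B hσ hc hB ha (by linarith) c L u p hcL c0 hu hp (by linarith)
  obtain ⟨v', hv', e3, e4⟩ := near σ' a' B' hσ' hc' hB' ha' (by linarith) c L u' p' hcL c0 hu' hp'
    (by linarith)
  have e5 := dist_triangle4 (σ s) (c v) (c v') (σ' s)
  rw [dist_comm (σ s) (c v), hcL.2 v hv v' hv'] at e5
  have e6 := abs_sub_le v s v'
  rw [abs_sub_comm s v'] at e6
  linarith

theorem AreIndependent.inv_left {g h : Y ≃ᵢ Y} (H : AreIndependent g h) : AreIndependent g⁻¹ h := by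
  intro x
  have := (H x).comp ((Homeomorph.neg ℤ).prodCongr (Homeomorph.refl ℤ)).isProperMap
  convert this using 1
  ext p
  simp [inv_zpow']

theorem AreIndependent.inv_right {g h : Y ≃ᵢ Y} (H : AreIndependent g h) :
    AreIndependent g h⁻¹ := by
  intro x
  have := (H x).comp ((Homeomorph.refl ℤ).prodCongr (Homeomorph.neg ℤ)).isProperMap
  convert this using 1
  ext p
  simp [inv_zpow']

/-- If the feet run off to infinity, the ray of `σ` passes within `B` of `α (m * a)` for every large
`m`, and each point of this ray is within `l` of some `σ (n * l)`. Infinitely many pairs `(m, n)`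
thus have bounded distance. -/
theorem not_areIndependent_of_feet {g h : Y ≃ᵢ Y} {α σ : ℝ → Y} {a l B : ℝ} (hα : Isometry α)
    (a0 : 0 < a) (ha : ∀ t, g (α t) = α (t + a)) (hσ : Isometry σ) (l0 : 0 < l)
    (hl : ∀ t, h (σ t) = σ (t + l)) (hB : IsContracting α B)
    (H : ∀ M, ∃ s, 0 ≤ s ∧ ∃ p, Foot α (σ s) p ∧ M ≤ p) : ¬ AreIndependent g h := by
  intro hind
  obtain ⟨b, hb⟩ := exists_foot hα (σ 0)
  have hB0 : 0 ≤ B := by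
    obtain ⟨s, hs, p, hp, hMp⟩ := H (b + 2 * B)
    obtain ⟨u, -, hd⟩ := hB _ _ b p (b + B) hb hp le_rfl (by linarith) _ s
      (isGeodesicPath_of_line hσ 0 hs) (by simp) (by simp)
    exact dist_nonneg.trans hd
  set C : ℝ≥0 := ⟨B + l + dist (σ 0) (α 0), by positivity⟩
  have hfin : ((fun p : ℤ × ℤ => nndist ((g ^ p.1) (α 0)) ((h ^ p.2) (α 0))) ⁻¹' Iic C).Finite :=
    isCompact_iff_finite.1 ((hind (α 0)).isCompact_preimage (by
      have : Iic C = Icc 0 C := by ext; simp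
      rw [this]
      exact isCompact_Icc))
  obtain ⟨m₀, hm₀⟩ := (hfin.image Prod.fst).bddAbove
  obtain ⟨m, hm⟩ := exists_nat_gt (max (m₀ : ℝ) ((b + B) / a))
  have hm1 : (m₀ : ℝ) < m := (le_max_left _ _).trans_lt hm
  have hm2 : b + B ≤ m * a := by
    have := ((le_max_right _ _).trans_lt hm).le
    rwa [div_le_iff₀ a0] at this
  obtain ⟨s, hs, p, hp, hMp⟩ := H (m * a + B)
  obtain ⟨u, hu, hd⟩ := hB _ _ b p (m * a) hb hp hm2 hMp _ s (isGeodesicPath_of_line hσ 0 hs)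
    (by simp) (by simp)
  set n : ℤ := ⌊u / l⌋
  have hn1 : n * l ≤ u := by
    have := Int.floor_le (u / l)
    rwa [le_div_iff₀ l0] at this
  have hn2 : u ≤ n * l + l := by
    have := (Int.lt_floor_add_one (u / l)).le
    rw [div_le_iff₀ l0] at this
    linarith
  have hmem : ((m : ℤ), n) ∈
      (fun p : ℤ × ℤ => nndist ((g ^ p.1) (α 0)) ((h ^ p.2) (α 0))) ⁻¹' Iic C := by
    rw [mem_preimage, mem_Iic, ← NNReal.coe_le_coe, coe_nndist]
    have e1 := zpow_apply_axis ha (m : ℤ) 0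
    have e2 := zpow_apply_axis hl n 0
    have e3 := dist_triangle4 ((g ^ (m : ℤ)) (α 0)) (σ (0 + u)) ((h ^ n) (σ 0)) ((h ^ n) (α 0))
    rw [(h ^ n).isometry.dist_eq, e2, hσ.dist_eq, Real.dist_eq, zero_add, zero_add,
      abs_of_nonneg (by linarith), e1, dist_comm (α _) (σ u), Int.cast_natCast, zero_add] at e3
    rw [zero_add] at hd
    rw [e1, Int.cast_natCast, zero_add]
    change _ ≤ B + l + dist (σ 0) (α 0)
    linarith
  have := hm₀ (mem_image_of_mem Prod.fst hmem)
  simp only at this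
  have h5 : ((m : ℤ) : ℝ) ≤ m₀ := by exact_mod_cast this
  rw [Int.cast_natCast] at h5
  linarith

theorem dist_pow_le {g : Y ≃ᵢ Y} {x : Y} {C : ℝ} (h : dist x (g x) ≤ C) (q : ℕ) :
    dist x ((g ^ q) x) ≤ q * C := by
  induction q with
  | zero => simp
  | succ q ih =>
    have h1 := dist_triangle x (g x) ((g ^ (q + 1)) x)
    rw [pow_succ', IsometryEquiv.mul_apply, g.isometry.dist_eq] at h1
    push_cast
    rw [pow_succ', IsometryEquiv.mul_apply]
    linarith

theorem IsAxis.inv {h : Y ≃ᵢ Y} {σ : ℝ → Y} (hσ : IsAxis h σ) : IsAxis h⁻¹ fun t => σ (-t) := by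
  obtain ⟨hi, l, l0, hl⟩ := hσ
  exact ⟨isometry_neg hi, l, l0, inv_apply_axis hl⟩

variable [CATZero Y] [ProperSpace Y]

/-- By independence the feet of `σ s` on the axis `α` of `g` stay bounded. A high power of `g ^ j`
moves them past a fixed point of `α`, so the geodesic from `σ s` to its image passes near that
point. The geodesic has bounded length, yet `σ s` goes to infinity. -/
theorem not_asymptotic_pow {g h : Y ≃ᵢ Y} {σ : ℝ → Y} (hg : IsRankOne g) (hσ : IsAxis h σ)
    (hind : AreIndependent g h) {j : ℕ} (hj : 0 < j) (C : ℝ)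
    (H : ∀ s, 0 ≤ s → dist (σ s) ((g ^ j) (σ s)) ≤ C) : False := by
  obtain ⟨α, hα, hF⟩ := hg
  obtain ⟨B, hB0, hB⟩ := exists_isContracting hα hF
  obtain ⟨hαi, a, a0, ha⟩ := hα
  obtain ⟨hσi, l, l0, hl⟩ := hσ
  have h1 : ∃ M, ∀ s, 0 ≤ s → ∀ p, Foot α (σ s) p → p < M := by
    by_contra! hcon
    exact not_areIndependent_of_feet hαi a0 ha hσi l0 hl hB
      (fun M => hcon M) hind
  have h2 : ∃ M, ∀ s, 0 ≤ s → ∀ p, Foot (fun t => α (-t)) (σ s) p → p < M := by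
    by_contra! hcon
    exact not_areIndependent_of_feet (isometry_neg hαi) a0 (inv_apply_axis ha) hσi l0 hl hB.neg
      (fun M => hcon M) hind.inv_left
  obtain ⟨M, hM⟩ := h1
  obtain ⟨M', hM'⟩ := h2
  obtain ⟨q, hq⟩ := exists_nat_ge ((M + M' + 2 * B) / a)
  rw [div_le_iff₀ a0] at hq
  have key : ∀ s, 0 ≤ s → dist (σ s) (α (M + B)) ≤ q * C + B := by
    intro s hs
    obtain ⟨p, hp⟩ := exists_foot hαi (σ s)
    have p1 := hM s hs p hp
    have p2 := hM' s hs (-p) hp.neg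
    have hp' := hp.zpow_axis ha ((j * q : ℕ) : ℤ)
    rw [zpow_natCast, pow_mul, Int.cast_natCast] at hp'
    have hjq : (q : ℝ) * a ≤ (j * q : ℕ) * a := by
      refine mul_le_mul_of_nonneg_right ?_ a0.le
      exact_mod_cast Nat.le_mul_of_pos_left q hj
    obtain ⟨c, hc, c0, cL⟩ := exists_isGeodesicPath (σ s) (((g ^ j) ^ q) (σ s))
    obtain ⟨u, hu, hd⟩ := hB _ _ _ _ (M + B) hp hp' (by linarith) (by linarith) c _ hc c0 cL
    have e1 := hc.dist_zero hu.1 hu.2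
    rw [c0] at e1
    linarith [dist_triangle (σ s) (c u) (α (M + B)), hu.2, dist_pow_le (H s hs) q]
  have hs : 0 ≤ q * C + B + dist (α (M + B)) (σ 0) + 1 := by
    linarith [dist_nonneg.trans (key 0 le_rfl), dist_nonneg (x := α (M + B)) (y := σ 0)]
  have e1 := key _ hs
  have e2 := dist_triangle (σ (q * C + B + dist (α (M + B)) (σ 0) + 1)) (α (M + B)) (σ 0)
  rw [hσi.dist_eq, Real.dist_eq, sub_zero, abs_of_nonneg hs] at e2
  linarith

theorem not_asymptotic_translates {g h : Y ≃ᵢ Y} {σ : ℝ → Y} (hg : IsRankOne g) (hσ : IsAxis h σ)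
    (hind : AreIndependent g h) {k k' : ℕ} (hk : k ≠ k') (C : ℝ)
    (H : ∀ s, 0 ≤ s → dist ((g ^ k) (σ s)) ((g ^ k') (σ s)) ≤ C) : False := by
  wlog hlt : k < k' generalizing k k'
  · exact this hk.symm (fun s hs => by rw [dist_comm]; exact H s hs)
      (lt_of_le_of_ne (not_lt.1 hlt) hk.symm)
  refine not_asymptotic_pow hg hσ hind (Nat.sub_pos_of_lt hlt) C fun s hs => ?_
  rw [← (g ^ k).isometry.dist_eq, ← IsometryEquiv.mul_apply, ← pow_add, Nat.add_sub_cancel' hlt.le]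
  exact H s hs

/-- A point with far feet on both translates would be reached from `σ 0` by a geodesic following
both of them. If this occurred arbitrarily far out, the translates would be asymptotic. -/
theorem exists_not_both_feet {g h : Y ≃ᵢ Y} {σ : ℝ → Y} (hg : IsRankOne g) (hσ : IsAxis h σ)
    {B : ℝ} (hB0 : 0 ≤ B) (hB : IsContracting σ B) (hind : AreIndependent g h) {k k' : ℕ}
    (hk : k ≠ k') : ∃ M, ∀ y p p', Foot (fun t => (g ^ k) (σ t)) y p →
      Foot (fun t => (g ^ k') (σ t)) y p' → M ≤ p → M ≤ p' → False := by
  by_contra! hcon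
  obtain ⟨C, hC⟩ := exists_dist_le_of_common_geodesics ((g ^ k).isometry.comp hσ.1)
    ((g ^ k').isometry.comp hσ.1) hB0 hB0 (hB.map (g ^ k)) (hB.map (g ^ k')) (σ 0) fun M => by
      obtain ⟨y, p, p', hp, hp', h1, h2, -⟩ := hcon M
      obtain ⟨c, hc, c0, cL⟩ := exists_isGeodesicPath (σ 0) y
      exact ⟨c, _, _, _, p, p', hc, c0, ⟨dist_nonneg, le_rfl⟩, ⟨dist_nonneg, le_rfl⟩, by rwa [cL],
        h1, by rwa [cL], h2⟩
  exact not_asymptotic_translates hg hσ hind hk C hC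

/-- The same argument at the negative ends, with the ray itself as the common geodesic. -/
theorem feet_bddBelow_or {g h : Y ≃ᵢ Y} {σ : ℝ → Y} (hg : IsRankOne g) (hσ : IsAxis h σ)
    {B : ℝ} (hB0 : 0 ≤ B) (hB : IsContracting σ B) (hind : AreIndependent g h) {k k' : ℕ}
    (hk : k ≠ k') (τ : GeodesicRay Y) :
    (∃ m, ∀ t p, Foot (fun t => (g ^ k) (σ t)) (τ.1 t) p → m ≤ p) ∨
      ∃ m, ∀ t p, Foot (fun t => (g ^ k') (σ t)) (τ.1 t) p → m ≤ p := by
  by_contra! hcon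
  obtain ⟨h1, h2⟩ := hcon
  have hi := isometry_neg hσ.1
  obtain ⟨C, hC⟩ := exists_dist_le_of_common_geodesics ((g ^ k).isometry.comp hi)
    ((g ^ k').isometry.comp hi) hB0 hB0 (hB.neg.map (g ^ k)) (hB.neg.map (g ^ k')) (τ.1 0)
    fun M => by
      obtain ⟨t, p, hp, h3⟩ := h1 (-M)
      obtain ⟨t', p', hp', h4⟩ := h2 (-M)
      refine ⟨_, max t t', t, t', -p, -p', τ.isGeodesicPath (le_max_of_le_left t.2), by simp,
        ⟨t.2, le_max_left _ _⟩, ⟨t'.2, le_max_right _ _⟩, ?_, by linarith, ?_, by linarith⟩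
      · rw [Real.toNNReal_coe]; exact hp.neg
      · rw [Real.toNNReal_coe]; exact hp'.neg
  exact not_asymptotic_translates hg hσ.inv hind.inv_right hk C hC

/-- Given two independent rank one isometries `g` and `h`, the isometries `g ^ k * h ^ N * g ^ (-k')`
move a ray so that the geodesics to its points from a given point pass close to `o`; at most one
exponent `k'` has to be avoided for a given ray, and at most one exponent `k` for a given point. -/
theorem exists_geodesics_near {g h : Y ≃ᵢ Y} (hg : IsRankOne g) (hh : IsRankOne h)
    (hind : AreIndependent g h) (o : Y) (τ : GeodesicRay Y) (n : ℕ) :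
    ∃ (P : Fin n → Y → Prop) (Q : Fin n → Prop), (∀ y k k', P k y → P k' y → k = k') ∧
      (∀ k k', Q k → Q k' → k = k') ∧ ∀ k k' : Fin n, ¬ Q k' → ∃ (N₀ : ℕ) (C : ℝ), ∀ N ≥ N₀,
        ∀ y, ¬ P k y → ∀ (t : ℝ≥0) (c : ℝ → Y) (L : ℝ), IsGeodesicPath c L → c 0 = y →
          c L = (g ^ (k : ℕ) * h ^ N * (g ^ (k' : ℕ))⁻¹) (τ.1 t) →
            ∃ u ∈ Icc 0 L, dist (c u) o ≤ C := by
  obtain ⟨σ, hσ, hF⟩ := hh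
  obtain ⟨B, hB0, hB⟩ := exists_isContracting hσ hF
  have hM : ∀ kk : Fin n × Fin n, ∃ M : ℝ, kk.1 ≠ kk.2 → ∀ y p p',
      Foot (fun t => (g ^ (kk.1 : ℕ)) (σ t)) y p →
      Foot (fun t => (g ^ (kk.2 : ℕ)) (σ t)) y p' → M ≤ p → M ≤ p' → False := by
    intro kk
    by_cases hk : kk.1 = kk.2
    · exact ⟨0, fun hne => absurd hk hne⟩
    · obtain ⟨M, hM⟩ := exists_not_both_feet hg hσ hB0 hB hind
        (fun hh => hk (Fin.ext hh) : (kk.1 : ℕ) ≠ kk.2)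
      exact ⟨M, fun _ => hM⟩
  choose M₀ hM₀ using hM
  obtain ⟨M, hM⟩ := Finite.exists_le M₀
  -- `P k y`: the point `y` lies far out towards the attracting end of `g ^ k ∘ σ`. `Q k`: the feet
  -- of the ray `τ` run off to the repelling end of `g ^ k ∘ σ`.
  refine ⟨fun k y => ∃ p, Foot (fun t => (g ^ (k : ℕ)) (σ t)) y p ∧ M ≤ p,
    fun k => ¬ ∃ m, ∀ t p, Foot (fun t => (g ^ (k : ℕ)) (σ t)) (τ.1 t) p → m ≤ p, ?_, ?_, ?_⟩
  · rintro y k k' ⟨p, hp, h1⟩ ⟨p', hp', h2⟩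
    by_contra hne
    exact hM₀ (k, k') hne y p p' hp hp' ((hM _).trans h1) ((hM _).trans h2)
  · intro k k' h1 h2
    by_contra hne
    exact (feet_bddBelow_or hg hσ hB0 hB hind (fun hh => hne (Fin.ext hh) : (k : ℕ) ≠ k') τ).elim
      h1 h2
  · intro k k' hQ
    obtain ⟨m, hm⟩ := not_not.1 hQ
    have hσ' := hσ
    obtain ⟨hi, l, l0, hl⟩ := hσ'
    -- The feet of `τ` on `g ^ k' ∘ σ` are at least `m`; after the move they lie on `g ^ k ∘ σ`
    -- beyond `M + 2 * B`, whereas `y` has its foot before `M`. Geodesics between them pass near the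
    -- point at `M + B`, independently of `N`.
    obtain ⟨N₀, hN₀⟩ := exists_nat_ge ((M + 2 * B - m) / l)
    rw [div_le_iff₀ l0] at hN₀
    refine ⟨N₀, B + dist ((g ^ (k : ℕ)) (σ (M + B))) o, fun N hN y hy t c L hc cy cL => ?_⟩
    obtain ⟨p, hp⟩ := exists_foot ((g ^ (k : ℕ)).isometry.comp hi) y
    have hpM : p < M := by
      by_contra! hcon
      exact hy ⟨p, hp, hcon⟩
    obtain ⟨q, hq⟩ := exists_foot ((g ^ (k' : ℕ)).isometry.comp hi) (τ.1 t)
    have hqm := hm t q hq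
    have hq1 : Foot σ ((g ^ (k' : ℕ))⁻¹ (τ.1 t)) q :=
      Foot.of_map (g := g ^ (k' : ℕ)) (by rw [IsometryEquiv.apply_inv_self]; exact hq)
    have hq2 := (hq1.zpow_axis hl N).map (g ^ (k : ℕ))
    rw [zpow_natCast, Int.cast_natCast] at hq2
    have hNN : (N₀ : ℝ) * l ≤ N * l := mul_le_mul_of_nonneg_right (by exact_mod_cast hN) l0.le
    obtain ⟨u, hu, hd⟩ := hB.map (g ^ (k : ℕ)) y _ p _ (M + B) hp hq2 (by linarith) (by linarith) c L
      hc cy cL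
    exact ⟨u, hu, (dist_triangle _ _ _).trans (add_le_add hd le_rfl)⟩

end Independent

/-! ### Rays and the cone topology -/

section Rays

variable {Y : Type*} [MetricSpace Y]

/-- The image of a ray under an isometry. -/
def GeodesicRay.map (τ : GeodesicRay Y) {Z : Type*} [MetricSpace Z] {f : Y → Z} (hf : Isometry f) :
    GeodesicRay Z :=
  ⟨fun t => f (τ.1 t), hf.comp τ.2⟩

variable [CATZero Y]

theorem GeodesicRay.dist_le_mul {ρ τ : GeodesicRay Y} (h : ρ.1 0 = τ.1 0) {s t : ℝ≥0} (hst : s ≤ t)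
    (ht : 0 < t) : dist (ρ.1 s) (τ.1 s) ≤ s / t * dist (ρ.1 t) (τ.1 t) := by
  have := (ρ.isGeodesicPath t.coe_nonneg).dist_le_mul (τ.isGeodesicPath t.coe_nonneg) (by simpa using h) s.coe_nonneg
    (NNReal.coe_le_coe.2 hst) (NNReal.coe_pos.2 ht)
  simpa only [Real.toNNReal_coe] using this

theorem GeodesicRay.eq_of_asymptotic {ρ τ : GeodesicRay Y} (h : ρ.1 0 = τ.1 0) (h' : ρ ≈ τ) :
    ρ = τ := by
  obtain ⟨C, hC⟩ := h'
  refine Subtype.ext (funext fun s => dist_le_zero.1 ?_)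
  have hlim : Tendsto (fun t : ℝ≥0 => (s : ℝ) / t * C) atTop (𝓝 0) := by
    have : Tendsto (fun t : ℝ≥0 => (s : ℝ) / t) atTop (𝓝 0) :=
      tendsto_const_nhds.div_atTop (NNReal.tendsto_coe_atTop.2 tendsto_id)
    simpa using this.mul_const C
  refine ge_of_tendsto hlim ?_
  filter_upwards [eventually_ge_atTop s, eventually_gt_atTop 0] with t h1 h2
  exact (GeodesicRay.dist_le_mul h h1 h2).trans
    (mul_le_mul_of_nonneg_left (hC t) (div_nonneg s.coe_nonneg t.coe_nonneg))

variable [ProperSpace Y]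

/-- A limit of the segments from `x` to `τ.1 n` along an ultrafilter. Segments with a common end
diverge at most as far as their origins, and this bound survives the limit. -/
theorem GeodesicRay.exists_asymptotic (τ : GeodesicRay Y) (x : Y) :
    ∃ ρ : GeodesicRay Y, ρ.1 0 = x ∧ ∀ t, dist (ρ.1 t) (τ.1 t) ≤ dist x (τ.1 0) := by
  choose c hc c0 cL using fun n : ℕ => exists_isGeodesicPath x (τ.1 n)
  have hfar : ∀ s : ℝ≥0, ∀ᶠ n : ℕ in (hyperfilter ℕ : Filter ℕ),
      (s : ℝ) ≤ n ∧ (s : ℝ) ≤ dist x (τ.1 n) := by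
    intro s
    refine Nat.hyperfilter_le_atTop ?_
    filter_upwards [tendsto_natCast_atTop_atTop.eventually_ge_atTop ((s : ℝ) + dist x (τ.1 0))]
      with n hn
    have h1 := dist_triangle_left (τ.1 0) (τ.1 n) x
    rw [τ.dist_eq, NNReal.coe_zero, NNReal.coe_natCast, zero_sub, abs_neg, Nat.abs_cast] at h1
    exact ⟨by linarith [dist_nonneg (x := x) (y := τ.1 0)], by linarith⟩
  have hlim : ∀ s : ℝ≥0, ∃ y, Tendsto (fun n => c n s) (hyperfilter ℕ : Filter ℕ) (𝓝 y) := by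
    refine fun s => exists_tendsto_of_bounded _ _ x s ((hfar s).mono fun n hn => ?_)
    have := (hc n).dist_zero s.coe_nonneg hn.2
    rw [c0] at this
    rw [dist_comm]
    exact this.le
  choose y hy using hlim
  refine ⟨⟨y, Isometry.of_dist_eq fun s t => ?_⟩, ?_, fun s => ?_⟩
  · refine tendsto_nhds_unique ((hy s).dist (hy t)) (tendsto_const_nhds.congr' ?_)
    filter_upwards [hfar s, hfar t] with n h1 h2
    rw [(hc n).2 s ⟨s.coe_nonneg, h1.2⟩ t ⟨t.coe_nonneg, h2.2⟩, NNReal.dist_eq]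
  · refine tendsto_nhds_unique (hy 0) (tendsto_const_nhds.congr fun n => ?_)
    rw [NNReal.coe_zero, c0]
  · refine le_of_tendsto ((hy s).dist tendsto_const_nhds) ?_
    filter_upwards [hfar s] with n hn
    have := (hc n).dist_le_of_eq_end (τ.isGeodesicPath n.cast_nonneg)
      (by rw [cL, Real.toNNReal_natCast]) s.coe_nonneg hn.2 hn.1
    rwa [c0, Real.toNNReal_coe, Real.toNNReal_zero] at this

theorem exists_ray (x : Y) (ξ : Boundary Y) :
    ∃ ρ : GeodesicRay Y, ρ.1 0 = x ∧ ρ.endpoint = ξ := by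
  induction ξ using Quotient.inductionOn with
  | h τ =>
    obtain ⟨ρ, h1, h2⟩ := τ.exists_asymptotic x
    exact ⟨ρ, h1, Quotient.sound ⟨_, h2⟩⟩

/-- The ray from `x` in the class `ξ`. -/
noncomputable def rayFrom (x : Y) (ξ : Boundary Y) : GeodesicRay Y := (exists_ray x ξ).choose

theorem rayFrom_zero (x : Y) (ξ : Boundary Y) : (rayFrom x ξ).1 0 = x :=
  (exists_ray x ξ).choose_spec.1

theorem endpoint_rayFrom (x : Y) (ξ : Boundary Y) : (rayFrom x ξ).endpoint = ξ :=
  (exists_ray x ξ).choose_spec.2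

theorem rayFrom_eq {x : Y} {ξ : Boundary Y} {τ : GeodesicRay Y} (h : τ.1 0 = x)
    (h' : τ.endpoint = ξ) : rayFrom x ξ = τ :=
  GeodesicRay.eq_of_asymptotic ((rayFrom_zero x ξ).trans h.symm)
    (Quotient.exact ((endpoint_rayFrom x ξ).trans h'.symm))

theorem dist_rayFrom_le (x : Y) (τ : GeodesicRay Y) (t : ℝ≥0) :
    dist ((rayFrom x τ.endpoint).1 t) (τ.1 t) ≤ dist x (τ.1 0) := by
  obtain ⟨ρ, h1, h2⟩ := τ.exists_asymptotic x
  rw [rayFrom_eq h1 (show ρ.endpoint = τ.endpoint from Quotient.sound ⟨_, h2⟩)]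
  exact h2 t

theorem ideal_mem_coneNhd {ρ : GeodesicRay Y} {R : ℝ≥0} {ε : ℝ} {η : Boundary Y} :
    Bordification.ideal η ∈ coneNhd ρ R ε ↔ dist ((rayFrom (ρ.1 0) η).1 R) (ρ.1 R) < ε := by
  constructor
  · rintro ⟨τ, h1, h2, h3⟩
    rwa [rayFrom_eq h1 h2]
  · exact fun h => ⟨_, rayFrom_zero _ _, endpoint_rayFrom _ _, h⟩

omit [ProperSpace Y] in
theorem coneNhd_subset {ρ : GeodesicRay Y} {R R' : ℝ≥0} {ε ε' : ℝ} (hR : R ≤ R') (hε : ε' ≤ ε) :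
    coneNhd ρ R' ε' ⊆ coneNhd ρ R ε := by
  have hR' : (R : ℝ) ≤ R' := NNReal.coe_le_coe.2 hR
  have hk : (R : ℝ) / R' ≤ 1 := div_le_one_of_le₀ hR' R'.coe_nonneg
  rcases eq_or_ne R R' with rfl | hne
  · rintro (y | η)
    · rintro ⟨h1, c, h2, h3, h4, h5⟩
      exact ⟨h1, c, h2, h3, h4, h5.trans_le hε⟩
    · rintro ⟨τ, h1, h2, h3⟩
      exact ⟨τ, h1, h2, h3.trans_le hε⟩
  have hpos : 0 < R' := lt_of_le_of_lt bot_le (lt_of_le_of_ne hR hne)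
  rintro (y | η)
  · rintro ⟨h1, c, h2, h3, h4, h5⟩
    refine ⟨hR'.trans_lt h1, c, h2, h3, h4, ?_⟩
    have := (h2.mono R'.coe_nonneg h1.le).dist_le_mul (ρ.isGeodesicPath R'.coe_nonneg) (by simpa using h3) R.coe_nonneg hR'
      (NNReal.coe_pos.2 hpos)
    simp only [Real.toNNReal_coe] at this
    have h6 := mul_le_of_le_one_left (dist_nonneg (x := c R') (y := ρ.1 R')) hk
    linarith
  · rintro ⟨τ, h1, h2, h3⟩
    refine ⟨τ, h1, h2, ?_⟩
    have := GeodesicRay.dist_le_mul h1 hR hpos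
    have h6 := mul_le_of_le_one_left (dist_nonneg (x := τ.1 R') (y := ρ.1 R')) hk
    linarith

/-- Change of base point: membership in a narrow, deep cone at `o` controls the geodesic from the
other base point at a late time `S`, and convexity shrinks this error at time `R'`. -/
theorem exists_coneNhd_subset (o : Y) {ξ : Boundary Y} {ρ' : GeodesicRay Y} {R' : ℝ≥0} {ε' : ℝ}
    (h : Bordification.ideal ξ ∈ coneNhd ρ' R' ε') :
    ∃ (R : ℝ≥0) (ε : ℝ), 0 < ε ∧ coneNhd (rayFrom o ξ) R ε ⊆ coneNhd ρ' R' ε' := by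
  rw [ideal_mem_coneNhd] at h
  set x := ρ'.1 0 with hx
  set τ := rayFrom x ξ with hτ
  set δ := ε' - dist (τ.1 R') (ρ'.1 R') with hδ
  have hδ0 : 0 < δ := by linarith
  set D : ℝ≥0 := nndist o x with hD
  have hDd : (D : ℝ) = dist o x := coe_nndist _ _
  -- The error at time `S` is at most `2 * D + 1`: twice the distance of the base points plus the
  -- width of the cone. The depth `S + D` ensures that points of the cone are still farther than `S`
  -- from `x`.
  obtain ⟨S, hS1, hS2⟩ : ∃ S : ℝ≥0, (R' : ℝ) + 1 ≤ S ∧ R' * (2 * D + 1) < δ * S := by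
    refine ⟨R' + 1 + (R' * (2 * D + 1) / δ).toNNReal, ?_, ?_⟩
    · push_cast
      linarith [NNReal.coe_nonneg (R' * (2 * D + 1) / δ).toNNReal]
    · push_cast
      rw [Real.coe_toNNReal _ (by positivity), mul_add δ, mul_div_cancel₀ _ hδ0.ne']
      have : 0 < δ * ((R' : ℝ) + 1) := by positivity
      linarith
  have hS0 : (0 : ℝ) < S := by linarith [R'.coe_nonneg]
  have hscale : ∀ d : ℝ, d ≤ 2 * D + 1 → (R' : ℝ) / S * d < δ := by
    intro d hd
    rw [div_mul_eq_mul_div, div_lt_iff₀ hS0]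
    exact (mul_le_mul_of_nonneg_left hd R'.coe_nonneg).trans_lt hS2
  have hρτ : ∀ t, dist ((rayFrom o ξ).1 t) (τ.1 t) ≤ D := by
    intro t
    have := dist_rayFrom_le o τ t
    rw [hτ, endpoint_rayFrom, rayFrom_zero] at this
    rwa [hDd]
  have hRS : R' ≤ S := NNReal.coe_le_coe.1 (by linarith)
  have hτ0 : τ.1 0 = x := rayFrom_zero _ _
  refine ⟨S + D, 1, one_pos, ?_⟩
  have hle : (S : ℝ) / (S + D : ℝ≥0) ≤ 1 :=
    div_le_one_of_le₀ (by push_cast; linarith [D.coe_nonneg]) (NNReal.coe_nonneg _)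
  have hpos : (0 : ℝ≥0) < S + D := add_pos_of_pos_of_nonneg (NNReal.coe_pos.1 hS0) bot_le
  rintro (y | η)
  · rintro ⟨h1, c, h2, h3, h4, h5⟩
    rw [rayFrom_zero] at h1 h2 h3 h4
    push_cast at h1
    have hxy : dist o y ≤ D + dist x y := by rw [hDd]; exact dist_triangle _ _ _
    have hD0 := D.coe_nonneg
    obtain ⟨c', k1, k2, k3⟩ := exists_isGeodesicPath x y
    refine ⟨by linarith, c', k1, k2, k3, ?_⟩
    have e1 := h2.dist_le_of_eq_end k1 (by rw [h4, k3]) S.coe_nonneg (by linarith : (S : ℝ) ≤ _)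
      (by linarith : (S : ℝ) ≤ _)
    rw [h3, k2, ← hDd] at e1
    have e2 := (h2.mono (NNReal.coe_nonneg (S + D)) (by push_cast; linarith)).dist_le_mul
      ((rayFrom o ξ).isGeodesicPath (NNReal.coe_nonneg (S + D)))
      (by rw [h3, Real.toNNReal_zero, rayFrom_zero]) S.coe_nonneg (by push_cast; linarith)
      (NNReal.coe_pos.2 hpos)
    simp only [Real.toNNReal_coe] at e2
    have e3 := mul_le_of_le_one_left
      (dist_nonneg (x := c (S + D : ℝ≥0)) (y := (rayFrom o ξ).1 (S + D))) hle
    have e4 := dist_triangle4 (c' S) (c S) ((rayFrom o ξ).1 S) (τ.1 S)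
    rw [dist_comm (c' S) (c S)] at e4
    have e5 := (k1.mono S.coe_nonneg (by linarith : (S : ℝ) ≤ _)).dist_le_mul (τ.isGeodesicPath S.coe_nonneg)
      (by rw [k2, Real.toNNReal_zero, hτ0]) R'.coe_nonneg (by linarith) hS0
    simp only [Real.toNNReal_coe] at e5
    have e6 := hscale (dist (c' S) (τ.1 S)) (by linarith [hρτ S])
    linarith [dist_triangle (c' R') (τ.1 R') (ρ'.1 R')]
  · intro h1
    rw [ideal_mem_coneNhd] at h1 ⊢
    rw [rayFrom_zero] at h1
    rw [← hx]
    have e1 := dist_rayFrom_le x (rayFrom o η) S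
    rw [endpoint_rayFrom, rayFrom_zero, dist_comm x o, ← hDd] at e1
    have e2 := GeodesicRay.dist_le_mul (ρ := rayFrom o η) (τ := rayFrom o ξ)
      (by rw [rayFrom_zero, rayFrom_zero]) (le_add_of_nonneg_right bot_le : S ≤ S + D) hpos
    have e3 := mul_le_of_le_one_left
      (dist_nonneg (x := (rayFrom o η).1 (S + D)) (y := (rayFrom o ξ).1 (S + D))) hle
    have e4 := dist_triangle4 ((rayFrom x η).1 S) ((rayFrom o η).1 S) ((rayFrom o ξ).1 S) (τ.1 S)
    have e5 := GeodesicRay.dist_le_mul (ρ := rayFrom x η) (τ := τ)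
      (by rw [rayFrom_zero, hτ0]) hRS (NNReal.coe_pos.1 hS0)
    have e6 := hscale (dist ((rayFrom x η).1 S) (τ.1 S)) (by linarith [hρτ S])
    linarith [dist_triangle ((rayFrom x η).1 R') (τ.1 R') (ρ'.1 R')]

theorem ideal_mem_coneNhd_rayFrom (o : Y) (ξ : Boundary Y) (R : ℝ≥0) {ε : ℝ} (hε : 0 < ε) :
    Bordification.ideal ξ ∈ coneNhd (rayFrom o ξ) R ε := by
  rw [ideal_mem_coneNhd, rayFrom_zero, dist_self]
  exact hε

/-- The truncated cones around the ray from a base point form a basis of neighborhoods. -/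
theorem hasBasis_nhds_ideal (o : Y) (ξ : Boundary Y) :
    (𝓝 (Bordification.ideal ξ)).HasBasis (fun p : ℝ≥0 × ℝ => 0 < p.2)
      fun p => coneNhd (rayFrom o ξ) p.1 p.2 := by
  refine ⟨fun s => ⟨fun hs => ?_, ?_⟩⟩
  · obtain ⟨t, hts, ht, hξ⟩ := mem_nhds_iff.1 hs
    obtain ⟨p, hp, hpt⟩ : ∃ p : ℝ≥0 × ℝ, 0 < p.2 ∧ coneNhd (rayFrom o ξ) p.1 p.2 ⊆ t := by
      clear hts hs
      induction ht with
      | basic t ht =>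
        rcases ht with ⟨O, -, rfl⟩ | ⟨ρ, R, ε, -, rfl⟩
        · obtain ⟨y, -, hy⟩ := hξ
          cases hy
        · obtain ⟨R, ε, h1, h2⟩ := exists_coneNhd_subset o hξ
          exact ⟨(R, ε), h1, h2⟩
      | univ => exact ⟨(0, 1), one_pos, subset_univ _⟩
      | inter s t _ _ ihs iht =>
        obtain ⟨p, hp, hps⟩ := ihs hξ.1
        obtain ⟨q, hq, hqt⟩ := iht hξ.2
        exact ⟨(max p.1 q.1, min p.2 q.2), lt_min hp hq, subset_inter
          ((coneNhd_subset (le_max_left _ _) (min_le_left _ _)).trans hps)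
          ((coneNhd_subset (le_max_right _ _) (min_le_right _ _)).trans hqt)⟩
      | sUnion S _ ih =>
        obtain ⟨t, htS, ht⟩ := hξ
        obtain ⟨p, hp, hpt⟩ := ih t htS ht
        exact ⟨p, hp, hpt.trans (subset_sUnion_of_mem htS)⟩
    exact ⟨p, hp, hpt.trans hts⟩
  · rintro ⟨p, hp, hps⟩
    refine mem_of_superset (IsOpen.mem_nhds ?_ (ideal_mem_coneNhd_rayFrom o ξ p.1 hp)) hps
    exact TopologicalSpace.isOpen_generateFrom_of_mem (Or.inr ⟨_, _, _, hp, rfl⟩)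

theorem ideal_mem_closure_iff (o : Y) {ξ : Boundary Y} {S : Set Y} :
    Bordification.ideal ξ ∈ closure (Bordification.point '' S) ↔ ∀ (R : ℝ≥0) (ε : ℝ), 0 < ε →
      ∃ y ∈ S, Bordification.point y ∈ coneNhd (rayFrom o ξ) R ε := by
  rw [mem_closure_iff_nhds_basis (hasBasis_nhds_ideal o ξ)]
  simp only [Prod.forall, exists_mem_image]

/-- The cone topology is the topology of pointwise convergence of rays from a base point. -/
theorem isInducing_rayFrom (o : Y) :
    IsInducing fun (ξ : Boundary Y) (R : ℝ≥0) => (rayFrom o ξ).1 R := by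
  rw [isInducing_iff_nhds]
  intro ξ
  have hb := (hasBasis_nhds_ideal o ξ).comap Bordification.ideal
  rw [nhds_induced]
  have hmem : ∀ (R : ℝ≥0) (ε : ℝ), Bordification.ideal ⁻¹' coneNhd (rayFrom o ξ) R ε =
      {η | dist ((rayFrom o η).1 R) ((rayFrom o ξ).1 R) < ε} := by
    intro R ε
    ext η
    rw [mem_preimage, ideal_mem_coneNhd, rayFrom_zero]
    rfl
  refine le_antisymm (tendsto_iff_comap.1 (tendsto_pi_nhds.2 fun R => ?_)) ?_
  · rw [Metric.tendsto_nhds]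
    intro ε hε
    have := hb.mem_of_mem (i := (R, ε)) hε
    rwa [hmem] at this
  · refine hb.ge_iff.2 fun p hp => ?_
    rw [hmem]
    exact ⟨{f | dist (f p.1) ((rayFrom o ξ).1 p.1) < p.2},
      (isOpen_lt ((continuous_apply p.1).dist continuous_const) continuous_const).mem_nhds
        (by rw [mem_ofPred_eq, dist_self]; exact hp), fun η hη => hη⟩

/-- Pointwise convergence becomes joint continuity because all rays are 1-Lipschitz. -/
theorem continuous_rayFrom (o : Y) :
    Continuous fun p : Boundary Y × ℝ≥0 => (rayFrom o p.1).1 p.2 := by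
  rw [continuous_iff_continuousAt]
  rintro ⟨ξ, s⟩
  have h1 : Tendsto (fun p : Boundary Y × ℝ≥0 => (rayFrom o p.1).1 s) (𝓝 (ξ, s))
      (𝓝 ((rayFrom o ξ).1 s)) :=
    (((continuous_apply s).comp (isInducing_rayFrom o).continuous).comp continuous_fst).tendsto _
  have h2 : Tendsto (fun p : Boundary Y × ℝ≥0 => dist p.2 s +
      dist ((rayFrom o p.1).1 s) ((rayFrom o ξ).1 s)) (𝓝 (ξ, s)) (𝓝 (0 + 0)) :=
    (tendsto_iff_dist_tendsto_zero.1 (continuous_snd.tendsto _)).add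
      (tendsto_iff_dist_tendsto_zero.1 h1)
  rw [add_zero] at h2
  refine tendsto_iff_dist_tendsto_zero.2 (squeeze_zero (fun _ => dist_nonneg) (fun p => ?_) h2)
  rw [← (rayFrom o p.1).2.dist_eq]
  exact dist_triangle _ _ _

/-- The point near `w` occurs on each geodesic before the time `U`, and the ray is close to the
geodesics to far points of `τ` up to that time. -/
theorem exists_rayFrom_near {o w : Y} {τ : GeodesicRay Y} {C : ℝ}
    (H : ∀ (t : ℝ≥0) (c : ℝ → Y) (L : ℝ), IsGeodesicPath c L → c 0 = o → c L = τ.1 t →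
      ∃ u ∈ Icc 0 L, dist (c u) w ≤ C) :
    ∃ s, dist ((rayFrom o τ.endpoint).1 s) w ≤ C + 1 := by
  set D : ℝ≥0 := nndist o (τ.1 0) with hD
  have hDd : (D : ℝ) = dist o (τ.1 0) := coe_nndist _ _
  have hC : 0 ≤ C := by
    obtain ⟨c, hc, c0, cL⟩ := exists_isGeodesicPath o (τ.1 0)
    obtain ⟨u, -, hu⟩ := H 0 c _ hc c0 cL
    exact dist_nonneg.trans hu
  set U : ℝ≥0 := ⟨C + dist o w, by positivity⟩
  have hU : (U : ℝ) = C + dist o w := rfl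
  -- At time `S` geodesic and ray are at most `2 * D` apart; convexity reduces this to at most `2 *
  -- D * U / S ≤ 1` before time `U`.
  set S : ℝ≥0 := 2 * D * U + U + 1 with hS
  have hS' : (S : ℝ) = 2 * D * U + U + 1 := by rw [hS]; push_cast; ring
  have hS0 : (0 : ℝ) < S := by rw [hS']; positivity
  obtain ⟨c, hc, c0, cL⟩ := exists_isGeodesicPath o (τ.1 (S + D))
  obtain ⟨u, hu, hd⟩ := H (S + D) c _ hc c0 cL
  have hL : (S : ℝ) ≤ dist o (τ.1 (S + D)) := by
    have := dist_triangle_left (τ.1 0) (τ.1 (S + D)) o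
    rw [τ.dist_eq, NNReal.coe_zero, zero_sub, abs_neg, NNReal.abs_eq, ← hDd] at this
    push_cast at this
    linarith
  have hD0 := D.coe_nonneg
  have hU0 := U.coe_nonneg
  have huU : u ≤ U := by
    have h1 := hc.dist_zero hu.1 hu.2
    rw [c0] at h1
    rw [hU]
    linarith [dist_triangle_right o (c u) w]
  have huS : u ≤ S := by
    have : 0 ≤ 2 * (D : ℝ) * U := by positivity
    linarith
  have e1 := hc.dist_le_of_eq_end (τ.isGeodesicPath (NNReal.coe_nonneg (S + D)))
    (by rw [cL, Real.toNNReal_coe]) S.coe_nonneg hL (by push_cast; linarith)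
  rw [c0, Real.toNNReal_coe, Real.toNNReal_zero, ← hDd] at e1
  have e2 := dist_rayFrom_le o τ S
  rw [← hDd] at e2
  set r := rayFrom o τ.endpoint
  have e3 := (hc.mono S.coe_nonneg hL).dist_le_mul (r.isGeodesicPath S.coe_nonneg)
    (by rw [c0, Real.toNNReal_zero, rayFrom_zero]) hu.1 huS hS0
  rw [Real.toNNReal_coe] at e3
  have e4 := dist_triangle_right (c S) (r.1 S) (τ.1 S)
  have e5 : u / S * dist (c S) (r.1 S) ≤ 1 := by
    rw [div_mul_eq_mul_div, div_le_one hS0]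
    have : dist (c S) (r.1 S) ≤ 2 * D := by linarith
    linarith [mul_le_mul huU this dist_nonneg hU0]
  refine ⟨u.toNNReal, ?_⟩
  have e6 := dist_triangle_left (r.1 u.toNNReal) w (c u)
  linarith

-- Contracting towards the common origin by `k` shows that `r` passes within `C + D` of `ρ.1 T`. The
-- time at which it does so differs from `T` by at most the same amount, hence the factor two.
omit [ProperSpace Y] in
theorem GeodesicRay.dist_le_of_between {r ρ : GeodesicRay Y} {z w : Y} {k C D : ℝ} {s T : ℝ≥0}
    (h0 : r.1 0 = ρ.1 0) (k0 : 0 ≤ k) (k1 : k ≤ 1) (hw : Between k (r.1 0) z w)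
    (hs : dist (r.1 s) z ≤ C) (hT : dist w (ρ.1 T) ≤ D) :
    dist (r.1 T) (ρ.1 T) ≤ 2 * (C + D) := by
  set k' : ℝ≥0 := ⟨k, k0⟩
  have hb := (r.isGeodesicPath s.coe_nonneg).between k0 k1
  rw [Real.toNNReal_zero, Real.toNNReal_coe,
    show k * (s : ℝ) = ((k' * s : ℝ≥0) : ℝ) from rfl, Real.toNNReal_coe] at hb
  have h1 := (hb.dist_le_mul hw k0 k1).trans
    ((mul_le_of_le_one_left dist_nonneg k1).trans hs)
  have h2 : dist (r.1 (k' * s)) (ρ.1 T) ≤ C + D := (dist_triangle _ _ _).trans (add_le_add h1 hT)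
  have h3 : |((k' * s : ℝ≥0) : ℝ) - T| ≤ C + D := by
    have a1 := r.dist_eq 0 (k' * s)
    have a2 := ρ.dist_eq 0 T
    rw [NNReal.coe_zero, zero_sub, abs_neg, NNReal.abs_eq] at a1 a2
    rw [← a1, ← a2, h0]
    have := abs_dist_sub_le (r.1 (k' * s)) (ρ.1 T) (ρ.1 0)
    rw [dist_comm (ρ.1 0) (r.1 _), dist_comm (ρ.1 0) (ρ.1 T)]
    exact this.trans h2
  have h4 := dist_triangle (r.1 T) (r.1 (k' * s)) (ρ.1 T)
  rw [r.dist_eq, abs_sub_comm] at h4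
  linarith

end Rays

/-! ### Products of `CAT(0)` spaces -/

section Product

variable {ι : Type*} [Fintype ι] {X : ι → Type*} [∀ i, MetricSpace (X i)]

theorem dist_sq_eq_sum (x z : PiLp 2 X) : dist x z ^ 2 = ∑ i, dist (x i) (z i) ^ 2 := by
  rw [← norm_distVec, EuclideanSpace.norm_sq_eq]
  simp [distVec]

theorem isometry_smul (γ : ∀ i, X i ≃ᵢ X i) : Isometry fun x : PiLp 2 X => γ • x := by
  refine Isometry.of_dist_eq fun x y => ?_
  rw [← sq_eq_sq₀ dist_nonneg dist_nonneg, dist_sq_eq_sum, dist_sq_eq_sum]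
  exact Finset.sum_congr rfl fun i _ => congrArg (· ^ 2) ((γ i).isometry.dist_eq (x i) (y i))

theorem slope_map (γ : ∀ i, X i ≃ᵢ X i) (τ : GeodesicRay (PiLp 2 X)) :
    GeodesicRay.slope (τ.map (isometry_smul γ)) = GeodesicRay.slope τ := by
  ext i
  exact (γ i).isometry.dist_eq _ _

theorem component_map (γ : ∀ i, X i ≃ᵢ X i) (τ : GeodesicRay (PiLp 2 X)) (i : ι)
    (h : 0 < GeodesicRay.slope (τ.map (isometry_smul γ)) i) (h' : 0 < GeodesicRay.slope τ i) :
    GeodesicRay.component (τ.map (isometry_smul γ)) i h =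
      (GeodesicRay.component τ i h').map (γ i).isometry := by
  refine Subtype.ext (funext fun t => ?_)
  simp only [GeodesicRay.component, slope_map]
  rfl

variable [∀ i, CATZero (X i)]

/-- The Stewart inequality is linear in squared distances, so the inequalities of the factors add
up. -/
instance : CATZero (PiLp 2 X) := by
  refine ⟨fun x y t h0 h1 => ?_⟩
  choose m hm using fun i => CATZero.exists_point (x i) (y i) t h0 h1
  refine ⟨WithLp.toLp 2 m, fun z => ?_⟩
  rw [dist_sq_eq_sum, dist_sq_eq_sum x z, dist_sq_eq_sum y z, dist_sq_eq_sum x y, Finset.mul_sum,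
    Finset.mul_sum, Finset.mul_sum, ← Finset.sum_add_distrib, ← Finset.sum_sub_distrib]
  exact Finset.sum_le_sum fun i _ => hm i (z i)

/-- The dividing points of the factors assemble to a dividing point of the product, which is unique.
-/
theorem Between.apply {t : ℝ} {x y m : PiLp 2 X} (h : Between t x y m) (h0 : 0 ≤ t) (h1 : t ≤ 1)
    (i : ι) : Between t (x i) (y i) (m i) := by
  choose n hn using fun i => exists_between (x i) (y i) h0 h1
  have hb : Between t x y (WithLp.toLp 2 n) := by
    constructor
    · rw [← sq_eq_sq₀ dist_nonneg (by positivity), mul_pow, dist_sq_eq_sum, dist_sq_eq_sum,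
        Finset.mul_sum]
      exact Finset.sum_congr rfl fun i _ => by rw [← mul_pow, ← (hn i).1]
    · have h1' : 0 ≤ 1 - t := by linarith
      rw [← sq_eq_sq₀ dist_nonneg (by positivity), mul_pow, dist_sq_eq_sum, dist_sq_eq_sum,
        Finset.mul_sum]
      exact Finset.sum_congr rfl fun i _ => by rw [← mul_pow, ← (hn i).2]
  rw [h.unique hb h0 h1]
  exact hn i

variable [∀ i, ProperSpace (X i)]

instance : ProperSpace (PiLp 2 X) := by
  refine ⟨fun x R => ?_⟩
  have hK : IsCompact ((WithLp.toLp 2 : (∀ i, X i) → PiLp 2 X) ''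
      Set.pi univ fun i => Metric.closedBall (x i) R) :=
    (isCompact_univ_pi fun i => isCompact_closedBall (x i) R).image
      (PiLp.continuous_toLp 2 X)
  refine hK.of_isClosed_subset Metric.isClosed_closedBall fun y hy => ⟨y.ofLp, fun i _ => ?_, rfl⟩
  exact (dist_apply_le y x i).trans hy

omit [∀ i, CATZero (X i)] [∀ i, ProperSpace (X i)] in
theorem component_endpoint (τ : GeodesicRay (PiLp 2 X)) (i : ι)
    (h : 0 < (GeodesicRay.endpoint τ).slope i) :
    (GeodesicRay.endpoint τ).component i h = (GeodesicRay.component τ i h).endpoint := rfl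

theorem slope_rayFrom (o : PiLp 2 X) (ξ : Boundary (PiLp 2 X)) :
    GeodesicRay.slope (rayFrom o ξ) = ξ.slope := by
  conv_rhs => rw [← endpoint_rayFrom o ξ]
  rfl

theorem component_rayFrom (o : PiLp 2 X) (ξ : Boundary (PiLp 2 X)) (i : ι)
    (h : 0 < ξ.slope i) (h' : 0 < GeodesicRay.slope (rayFrom o ξ) i) :
    GeodesicRay.component (rayFrom o ξ) i h' = rayFrom (o i) (ξ.component i h) := by
  refine (rayFrom_eq ?_ ?_).symm
  · change (rayFrom o ξ).1 (0 / _) i = o i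
    rw [zero_div, rayFrom_zero]
  · rw [← component_endpoint _ _ (by rwa [endpoint_rayFrom])]
    congr 1
    exact endpoint_rayFrom o ξ

theorem rayFrom_component_apply (o : PiLp 2 X) (ξ : Boundary (PiLp 2 X)) (i : ι)
    (h : 0 < ξ.slope i) (t : ℝ≥0) :
    (rayFrom (o i) (ξ.component i h)).1 t = (rayFrom o ξ).1 (t / (ξ.slope i).toNNReal) i := by
  have h' : 0 < GeodesicRay.slope (rayFrom o ξ) i := by rwa [slope_rayFrom]
  rw [← component_rayFrom o ξ i h h']
  simp only [GeodesicRay.component, slope_rayFrom]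

theorem rayFrom_apply (o : PiLp 2 X) (ξ : Boundary (PiLp 2 X)) (i : ι)
    (h : 0 < ξ.slope i) (t : ℝ≥0) :
    (rayFrom o ξ).1 t i = (rayFrom (o i) (ξ.component i h)).1 ((ξ.slope i).toNNReal * t) := by
  rw [rayFrom_component_apply, mul_div_cancel_left₀]
  exact (Real.toNNReal_pos.2 h).ne'

/-- The point at time `t` of the path with slope `θ` whose projections represent `η`. -/
noncomputable def productPoint (o : PiLp 2 X) (η : FurstenbergBoundary X) (θ : EuclideanSpace ℝ ι)
    (t : ℝ≥0) : PiLp 2 X :=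
  WithLp.toLp 2 fun i => (rayFrom (o i) (η i)).1 ((θ i).toNNReal * t)

/-- The ray with slope `θ` whose projections represent `η`. -/
noncomputable def productRay (o : PiLp 2 X) (η : FurstenbergBoundary X) {θ : EuclideanSpace ℝ ι}
    (hθ : θ ∈ regularSlopes ι) : GeodesicRay (PiLp 2 X) :=
  ⟨productPoint o η θ, Isometry.of_dist_eq fun s t => by
    rw [← sq_eq_sq₀ dist_nonneg dist_nonneg, dist_sq_eq_sum, NNReal.dist_eq, sq_abs]
    have h1 : ∑ i, θ i ^ 2 = 1 := by
      have := EuclideanSpace.norm_sq_eq θ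
      rw [hθ.2] at this
      simpa using this.symm
    rw [← one_mul (((s : ℝ) - t) ^ 2), ← h1, Finset.sum_mul]
    refine Finset.sum_congr rfl fun i _ => ?_
    change dist ((rayFrom (o i) (η i)).1 _) ((rayFrom (o i) (η i)).1 _) ^ 2 = _
    rw [GeodesicRay.dist_eq, sq_abs, NNReal.coe_mul, NNReal.coe_mul,
      Real.coe_toNNReal _ (hθ.1 i).le]
    ring⟩

theorem slope_productRay (o : PiLp 2 X) (η : FurstenbergBoundary X) {θ : EuclideanSpace ℝ ι}
    (hθ : θ ∈ regularSlopes ι) : GeodesicRay.slope (productRay o η hθ) = θ := by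
  ext i
  change dist ((rayFrom (o i) (η i)).1 _) ((rayFrom (o i) (η i)).1 _) = _
  rw [GeodesicRay.dist_eq, NNReal.coe_mul, NNReal.coe_mul, Real.coe_toNNReal _ (hθ.1 i).le]
  simp [abs_of_pos (hθ.1 i)]

theorem component_productRay (o : PiLp 2 X) (η : FurstenbergBoundary X) {θ : EuclideanSpace ℝ ι}
    (hθ : θ ∈ regularSlopes ι) (i : ι) (h : 0 < GeodesicRay.slope (productRay o η hθ) i) :
    GeodesicRay.component (productRay o η hθ) i h = rayFrom (o i) (η i) := by
  refine Subtype.ext (funext fun t => ?_)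
  change (rayFrom (o i) (η i)).1 ((θ i).toNNReal *
    (t / (GeodesicRay.slope (productRay o η hθ) i).toNNReal)) = _
  rw [slope_productRay, mul_div_cancel₀]
  exact (Real.toNNReal_pos.2 (hθ.1 i)).ne'

theorem rayFrom_eq_productPoint (o : PiLp 2 X) (ξ : regularBoundary X) (t : ℝ≥0) :
    (rayFrom o ξ.1).1 t = productPoint o (furstenbergProj ξ) ξ.1.slope t := by
  ext i
  exact rayFrom_apply o ξ.1 i (ξ.2.1 i) t

omit [Fintype ι] in
theorem continuous_productPoint (o : PiLp 2 X) (t : ℝ≥0) :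
    Continuous fun p : FurstenbergBoundary X × EuclideanSpace ℝ ι =>
      productPoint o p.1 p.2 t := by
  refine (PiLp.continuous_toLp 2 X).comp (continuous_pi fun i => ?_)
  refine (continuous_rayFrom (o i)).comp (Continuous.prodMk ?_ ?_)
  · exact (continuous_apply i).comp continuous_fst
  · exact (continuous_real_toNNReal.comp ((EuclideanSpace.proj i).continuous.comp
      continuous_snd)).mul continuous_const

/-- The Furstenberg projection and the slope determine the topology of the regular boundary. -/
theorem isInducing_furstenbergProj_slope (o : PiLp 2 X) :
    IsInducing fun ξ : regularBoundary X => (furstenbergProj ξ, ξ.1.slope) := by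
  have hJ : IsInducing fun (ξ : regularBoundary X) (R : ℝ≥0) => (rayFrom o ξ.1).1 R :=
    (isInducing_rayFrom o).comp IsInducing.subtypeVal
  have happ : ∀ i, Continuous fun p : regularBoundary X × ℝ≥0 => (rayFrom o p.1.1).1 p.2 i :=
    fun i => (PiLp.continuous_apply 2 X i).comp ((continuous_rayFrom o).comp
      ((continuous_subtype_val.comp continuous_fst).prodMk continuous_snd))
  have hslope : Continuous fun ξ : regularBoundary X => ξ.1.slope := by
    have h1 : Continuous fun ξ : regularBoundary X => (WithLp.toLp 2 fun i =>
        dist ((rayFrom o ξ.1).1 0 i) ((rayFrom o ξ.1).1 1 i) : EuclideanSpace ℝ ι) := by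
      refine (PiLp.continuous_toLp 2 _).comp (continuous_pi fun i => ?_)
      exact ((happ i).comp (continuous_id.prodMk continuous_const)).dist
        ((happ i).comp (continuous_id.prodMk continuous_const))
    convert h1 using 2 with ξ
    rw [← slope_rayFrom o]
    rfl
  have hproj : Continuous fun ξ : regularBoundary X => furstenbergProj ξ := by
    refine continuous_pi fun i => (isInducing_rayFrom (o i)).continuous_iff.2
      (continuous_pi fun R => ?_)
    have h1 : Continuous fun ξ : regularBoundary X =>
        (rayFrom o ξ.1).1 (R / (ξ.1.slope i).toNNReal) i := by
      refine (happ i).comp (continuous_id.prodMk (Continuous.div₀ continuous_const ?_ fun ξ =>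
        (Real.toNNReal_pos.2 (ξ.2.1 i)).ne'))
      exact continuous_real_toNNReal.comp ((EuclideanSpace.proj i).continuous.comp hslope)
    convert h1 using 2 with ξ
    exact rayFrom_component_apply o ξ.1 i (ξ.2.1 i) R
  have hK : Continuous fun (p : FurstenbergBoundary X × EuclideanSpace ℝ ι) (t : ℝ≥0) =>
      productPoint o p.1 p.2 t := continuous_pi (continuous_productPoint o)
  -- The pair depends continuously on the point, and the ray, which carries the topology, is
  -- recovered continuously from the pair. For this `productPoint` has to make sense for every `θ`,
  -- not only for slopes.
  refine IsInducing.of_comp (hproj.prodMk hslope) hK ?_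
  convert hJ using 1
  funext ξ t
  exact (rayFrom_eq_productPoint o ξ t).symm

theorem furstenbergProj_slope_injective (o : PiLp 2 X) :
    Function.Injective fun ξ : regularBoundary X => (furstenbergProj ξ, ξ.1.slope) := by
  intro ξ ξ' h
  obtain ⟨h1, h2⟩ := Prod.ext_iff.1 h
  simp only at h1 h2
  have h3 : rayFrom o ξ.1 = rayFrom o ξ'.1 := Subtype.ext (funext fun t => by
    rw [rayFrom_eq_productPoint, rayFrom_eq_productPoint, h1, h2])
  refine Subtype.ext ?_
  rw [← endpoint_rayFrom o ξ.1, h3, endpoint_rayFrom]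

end Product

/-! ### Limit sets -/

section LimitSet

variable {ι : Type*} [Fintype ι] {X : ι → Type*} [∀ i, MetricSpace (X i)]
  [∀ i, CATZero (X i)] [∀ i, ProperSpace (X i)]

omit [∀ i, CATZero (X i)] [∀ i, ProperSpace (X i)] in
theorem isClosed_limitSet (Γ : Subgroup (∀ i, X i ≃ᵢ X i)) (o : PiLp 2 X) :
    IsClosed (limitSet Γ o) :=
  isClosed_closure.preimage continuous_induced_dom

theorem mem_limitSet_iff (Γ : Subgroup (∀ i, X i ≃ᵢ X i)) (o x : PiLp 2 X)
    {ξ : Boundary (PiLp 2 X)} : ξ ∈ limitSet Γ o ↔ ∀ (R : ℝ≥0) (ε : ℝ), 0 < ε →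
      ∃ γ ∈ Γ, Bordification.point (γ • o) ∈ coneNhd (rayFrom x ξ) R ε := by
  rw [limitSet, mem_ofPred_eq, ideal_mem_closure_iff x]
  refine forall_congr' fun R => forall_congr' fun ε => imp_congr_right fun _ => ?_
  constructor
  · rintro ⟨-, ⟨γ, rfl⟩, h⟩
    exact ⟨γ.1, γ.2, h⟩
  · rintro ⟨γ, hγ, h⟩
    exact ⟨_, ⟨⟨γ, hγ⟩, rfl⟩, h⟩

/-- `γ` carries the geodesics from `o` to the orbit to geodesics from `γ • o`, so the cone criterion
transfers verbatim when the cones of the image are based at `γ • o`. -/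
theorem map_mem_limitSet {Γ : Subgroup (∀ i, X i ≃ᵢ X i)} {o : PiLp 2 X}
    {ξ : Boundary (PiLp 2 X)} (hξ : ξ ∈ limitSet Γ o) {γ : ∀ i, X i ≃ᵢ X i} (hγ : γ ∈ Γ) :
    GeodesicRay.endpoint ((rayFrom o ξ).map (isometry_smul γ)) ∈ limitSet Γ o := by
  rw [mem_limitSet_iff Γ o (γ • o)]
  intro R ε hε
  obtain ⟨δ, hδ, h1, c, h2, h3, h4, h5⟩ := (mem_limitSet_iff Γ o o).1 hξ R ε hε
  have hi := isometry_smul γ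
  rw [rayFrom_zero] at h1 h2 h3 h4
  have hr : rayFrom (γ • o) (GeodesicRay.endpoint ((rayFrom o ξ).map hi)) =
      (rayFrom o ξ).map hi :=
    rayFrom_eq (congrArg (γ • ·) (rayFrom_zero o ξ)) rfl
  refine ⟨γ * δ, Γ.mul_mem hγ hδ, ?_⟩
  rw [hr]
  have hd : dist (((rayFrom o ξ).map hi).1 0) ((γ * δ) • o) = dist o (δ • o) := by
    rw [← hi.dist_eq o, mul_smul]
    congr 1
    exact congrArg (γ • ·) (rayFrom_zero o ξ)
  refine ⟨by rwa [hd], fun t => γ • c t, ?_, ?_, ?_, ?_⟩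
  · rw [hd]
    exact h2.map hi
  · change γ • c 0 = γ • (rayFrom o ξ).1 0
    rw [h3, rayFrom_zero]
  · change γ • c _ = _
    rw [hd, h4, mul_smul]
  · exact (hi.dist_eq _ _).trans_lt h5

/-- The geodesic from `o` to a suitable orbit point fellow-travels with the ray up to time `n`. Its
point at time `n` divides the projections to all factors in the same ratio. -/
theorem exists_approximation {Γ : Subgroup (∀ i, X i ≃ᵢ X i)} {o : PiLp 2 X}
    {ξ : Boundary (PiLp 2 X)} (hξ : ξ ∈ limitSet Γ o) (n : ℕ) :
    ∃ γ ∈ Γ, ∃ (w : PiLp 2 X) (k : ℝ), 0 ≤ k ∧ k ≤ 1 ∧ (∀ i, Between k (o i) (γ i (o i)) (w i)) ∧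
      ∀ i, dist (w i) ((rayFrom o ξ).1 n i) ≤ 1 := by
  obtain ⟨γ, hγ, h1, c, h2, h3, h4, h5⟩ := (mem_limitSet_iff Γ o o).1 hξ n 1 one_pos
  rw [rayFrom_zero] at h1 h2 h3 h4
  set L := dist o (γ • o)
  rw [NNReal.coe_natCast] at h1 h5
  have hL : 0 < L := n.cast_nonneg.trans_lt h1
  have k0 : 0 ≤ (n : ℝ) / L := by positivity
  have k1 : (n : ℝ) / L ≤ 1 := (div_le_one hL).2 h1.le
  have hb := h2.between k0 k1
  rw [h3, h4, div_mul_cancel₀ _ hL.ne'] at hb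
  exact ⟨γ, hγ, c n, n / L, k0, k1, fun i => hb.apply k0 k1 i,
    fun i => (dist_apply_le _ _ i).trans h5.le⟩

theorem exists_forall_not_of_card_lt {α β : Type*} [Fintype α] [Fintype β]
    (h : Fintype.card α < Fintype.card β) (P : α → β → Prop)
    (hP : ∀ a b b', P a b → P a b' → b = b') : ∃ b, ∀ a, ¬ P a b := by
  by_contra! hcon
  choose f hf using hcon
  exact absurd (Fintype.card_le_of_injective f fun b b' hbb => hP (f b) b b' (hf b) (hbb ▸ hf b'))
    (not_le.2 h)

/-- Any direction of the Furstenberg limit set can be combined with any slope of a limit point. -/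
theorem endpoint_productRay_mem_limitSet {Γ : Subgroup (∀ i, X i ≃ᵢ X i)} {o : PiLp 2 X}
    {g h : ∀ i, X i ≃ᵢ X i} (hgΓ : g ∈ Γ) (hhΓ : h ∈ Γ) (hg : IsRegularAxial g)
    (hh : IsRegularAxial h) (hind : ∀ i, AreIndependent (g i) (h i)) (η : regularBoundary X)
    (hη : η.1 ∈ limitSet Γ o) (ξ : regularBoundary X) (hξ : ξ.1 ∈ limitSet Γ o) :
    GeodesicRay.endpoint (productRay o (furstenbergProj η) ξ.2) ∈ limitSet Γ o := by
  classical
  have hcard : Fintype.card ι < Fintype.card (Fin (Fintype.card ι + 1)) := by simp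
  set τ : ∀ i, GeodesicRay (X i) := fun i => rayFrom (o i) (furstenbergProj ξ i) with hτ
  choose P Q hP hQ hN using fun i =>
    exists_geodesics_near (hg i) (hh i) (hind i) (o i) (τ i) (Fintype.card ι + 1)
  -- The exponent `k'` depends only on `ξ`, whereas `k` below varies with `n`. The constants `N` and
  -- `C` are therefore taken over all factors and exponents, and serve every `n`.
  obtain ⟨k', hk'⟩ := exists_forall_not_of_card_lt hcard Q hQ
  choose N₀ C₀ hNC using fun (i : ι) (k : Fin (Fintype.card ι + 1)) => hN i k k' (hk' i)
  obtain ⟨N, hNle⟩ := Finite.exists_le fun p : ι × Fin (Fintype.card ι + 1) => N₀ p.1 p.2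
  obtain ⟨C, hCle⟩ := Finite.exists_le fun p : ι × Fin (Fintype.card ι + 1) => C₀ p.1 p.2
  choose γ hγ w κ κ0 κ1 hw hwn using exists_approximation hη
  have hk : ∀ n, ∃ k, ∀ i, ¬ P i k ((γ n i)⁻¹ (o i)) := fun n =>
    exists_forall_not_of_card_lt hcard (fun i k => P i k ((γ n i)⁻¹ (o i))) fun i => hP i _
  choose k hk using hk
  set β : ℕ → ∀ i, X i ≃ᵢ X i := fun n =>
    γ n * (g ^ (k n : ℕ) * h ^ N * (g ^ (k' : ℕ))⁻¹) with hβ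
  have hβΓ : ∀ n, β n ∈ Γ := fun n => Γ.mul_mem (hγ n) (Γ.mul_mem (Γ.mul_mem
    (Γ.pow_mem hgΓ _) (Γ.pow_mem hhΓ _)) (Γ.inv_mem (Γ.pow_mem hgΓ _)))
  set ω : ℕ → Boundary (PiLp 2 X) := fun n =>
    GeodesicRay.endpoint ((rayFrom o ξ.1).map (isometry_smul (β n))) with hω
  have hωΓ : ∀ n, ω n ∈ limitSet Γ o := fun n => map_mem_limitSet hξ (hβΓ n)
  have hslope : ∀ n, (ω n).slope = ξ.1.slope := fun n =>
    (slope_map (β n) (rayFrom o ξ.1)).trans (slope_rayFrom o ξ.1)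
  have hcomp : ∀ n i (hp : 0 < (ω n).slope i),
      (ω n).component i hp = ((τ i).map (β n i).isometry).endpoint := by
    intro n i hp
    have hp' : 0 < GeodesicRay.slope (rayFrom o ξ.1) i := by
      rw [slope_rayFrom]; exact ξ.2.1 i
    have e := component_map (β n) (rayFrom o ξ.1) i hp hp'
    rw [component_rayFrom o ξ.1 i (ξ.2.1 i) hp'] at e
    exact congrArg GeodesicRay.endpoint e
  -- Translated by `(γ n)⁻¹`, the claim concerns geodesics from `(γ n)⁻¹ • o` that pass near `o`,
  -- which the inserted element provides.
  have hnear : ∀ n i, ∃ s, dist ((rayFrom (o i) ((τ i).map (β n i).isometry).endpoint).1 s)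
      (γ n i (o i)) ≤ C + 1 := by
    refine fun n i => exists_rayFrom_near fun t c L hc c0 cL => ?_
    obtain ⟨u, hu, hd⟩ := hNC i (k n) N (hNle (i, k n)) _ (hk n i) t _ L
      (hc.map (γ n i)⁻¹.isometry) (by rw [c0]) (by
        rw [cL]
        exact (γ n i).symm_apply_apply _)
    refine ⟨u, hu, ?_⟩
    rw [← (γ n i).isometry.dist_eq, IsometryEquiv.apply_inv_self] at hd
    exact hd.trans (hCle (i, k n))
  refine (isClosed_limitSet Γ o).mem_of_tendsto (f := ω) (b := atTop) ?_
    (Eventually.of_forall hωΓ)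
  rw [(isInducing_rayFrom o).tendsto_nhds_iff, tendsto_pi_nhds]
  intro R
  have hr : rayFrom o (GeodesicRay.endpoint (productRay o (furstenbergProj η) ξ.2)) =
      productRay o (furstenbergProj η) ξ.2 := by
    refine rayFrom_eq ?_ rfl
    ext i
    change (rayFrom (o i) _).1 (_ * 0) = _
    rw [mul_zero, rayFrom_zero]
  rw [hr]
  refine ((PiLp.continuous_toLp 2 X).tendsto _).comp
    (tendsto_pi_nhds (f := fun n i => (rayFrom o (ω n)).1 R i).2 fun i => ?_)
  have hθ : 0 < ξ.1.slope i := ξ.2.1 i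
  have hθη : 0 < η.1.slope i := η.2.1 i
  change Tendsto (fun n => (rayFrom o (ω n)).1 R i) atTop
    (𝓝 ((rayFrom (o i) (furstenbergProj η i)).1 ((ξ.1.slope i).toNNReal * R)))
  have hωi : ∀ n, (rayFrom o (ω n)).1 R i =
      (rayFrom (o i) ((τ i).map (β n i).isometry).endpoint).1 ((ξ.1.slope i).toNNReal * R) := by
    intro n
    have hp : 0 < (ω n).slope i := by rw [hslope]; exact hθ
    rw [rayFrom_apply o (ω n) i hp, hcomp, hslope]
  simp only [hωi]
  set S := (ξ.1.slope i).toNNReal * R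
  -- At a time proportional to `n` the two rays are still at bounded distance, so they converge at
  -- the fixed time `S` at rate `1 / n`. Regularity of `η` makes the factor of proportionality
  -- positive.
  have hclose : ∀ n : ℕ, dist ((rayFrom (o i) ((τ i).map (β n i).isometry).endpoint).1
      ((η.1.slope i).toNNReal * n)) ((rayFrom (o i) (furstenbergProj η i)).1
      ((η.1.slope i).toNNReal * n)) ≤ 2 * (C + 1 + 1) := by
    intro n
    obtain ⟨s, hs⟩ := hnear n i
    refine GeodesicRay.dist_le_of_between (by rw [rayFrom_zero, rayFrom_zero]) (κ0 n) (κ1 n)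
      (by rw [rayFrom_zero]; exact hw n i) hs ?_
    have := hwn n i
    rwa [rayFrom_apply o η.1 i hθη] at this
  have hT : Tendsto (fun n : ℕ => (η.1.slope i).toNNReal * (n : ℝ≥0)) atTop atTop :=
    tendsto_natCast_atTop_atTop.const_mul_atTop (Real.toNNReal_pos.2 hθη)
  have hlim : Tendsto (fun n : ℕ => (S : ℝ) / ((η.1.slope i).toNNReal * (n : ℝ≥0) : ℝ≥0) *
      (2 * (C + 1 + 1))) atTop (𝓝 0) := by
    have h1 : Tendsto (fun n : ℕ => (S : ℝ) / ((η.1.slope i).toNNReal * (n : ℝ≥0) : ℝ≥0)) atTop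
        (𝓝 0) := tendsto_const_nhds.div_atTop (NNReal.tendsto_coe_atTop.2 hT)
    simpa only [zero_mul] using h1.mul_const (2 * (C + 1 + 1))
  refine tendsto_iff_dist_tendsto_zero.2
    (squeeze_zero' (Eventually.of_forall fun _ => dist_nonneg) ?_ hlim)
  filter_upwards [hT.eventually_ge_atTop S, hT.eventually_gt_atTop 0] with n h1 h2
  exact (GeodesicRay.dist_le_mul (by rw [rayFrom_zero, rayFrom_zero]) h1 h2).trans
    (mul_le_mul_of_nonneg_left (hclose n) (div_nonneg (NNReal.coe_nonneg _) (NNReal.coe_nonneg _)))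

end LimitSet

end HadamardProduct

theorem theoremB {r : ℕ} {X : Fin r → Type*} [∀ i, MetricSpace (X i)]
    [∀ i, LocallyCompactSpace (X i)] (hX : ∀ i, IsHadamard (X i))
    (Γ : Subgroup (∀ i, X i ≃ᵢ X i)) (hΓ : ProperlyDiscontinuousSMul Γ (PiLp 2 X))
    (hind : ∃ g ∈ Γ, ∃ h ∈ Γ, IsRegularAxial g ∧ IsRegularAxial h ∧
      ∀ i, AreIndependent (g i) (h i))
    (o : PiLp 2 X) :
    ∃ Φ : ↥(limitSet Γ o ∩ regularBoundary X) ≃ₜ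
        ↥(furstenbergLimitSet Γ o ×ˢ regularLimitSlopes Γ o),
      ∀ ξ, (Φ ξ : FurstenbergBoundary X × EuclideanSpace ℝ (Fin r)) =
        (furstenbergProj ⟨ξ.1, ξ.2.2⟩, Boundary.slope ξ.1) := by
  have : ∀ i, CATZero (X i) := fun i => (hX i).catZero
  have : ∀ i, ProperSpace (X i) := fun i => by
    have := (hX i).complete
    exact properSpace_of_geodesic
  obtain ⟨g, hgΓ, h, hhΓ, hg, hh, hgh⟩ := hind
  set Ψ : regularBoundary X → FurstenbergBoundary X × EuclideanSpace ℝ (Fin r) :=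
    fun ξ => (furstenbergProj ξ, ξ.1.slope)
  set j : ↥(limitSet Γ o ∩ regularBoundary X) → regularBoundary X := fun ξ => ⟨ξ.1, ξ.2.2⟩
  have hmem : ∀ ξ, Ψ (j ξ) ∈ furstenbergLimitSet Γ o ×ˢ regularLimitSlopes Γ o := fun ξ =>
    ⟨⟨j ξ, ξ.2.1, rfl⟩, ⟨⟨fun i => (ξ.2.2.1 i).le, ξ.2.2.2⟩, ξ.1, ξ.2.1, rfl⟩, ξ.2.2⟩
  set Φ : ↥(limitSet Γ o ∩ regularBoundary X) →
    ↥(furstenbergLimitSet Γ o ×ˢ regularLimitSlopes Γ o) := fun ξ => ⟨Ψ (j ξ), hmem ξ⟩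
  have hinj : Function.Injective Φ := fun ξ ξ' hξ => by
    have hj : j ξ = j ξ' := furstenbergProj_slope_injective o (congrArg Subtype.val hξ)
    exact Subtype.ext (congrArg (fun x : regularBoundary X => x.1) hj)
  -- The direction comes from one limit point and the slope from another; only here are the two
  -- independent elements of `Γ` needed.
  have hsurj : Function.Surjective Φ := by
    rintro ⟨⟨η, θ⟩, hη, hθ⟩
    obtain ⟨ξ₁, h1, e1⟩ := hη
    obtain ⟨⟨-, ξ₂, h2, e2⟩, hθ⟩ := hθ
    simp only at e1 e2 hθ
    subst e1 e2
    have hω := endpoint_productRay_mem_limitSet hgΓ hhΓ hg hh hgh ξ₁ h1 ⟨ξ₂, hθ⟩ h2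
    have hs : (GeodesicRay.endpoint (productRay o (furstenbergProj ξ₁) hθ)).slope = ξ₂.slope :=
      slope_productRay o _ hθ
    have hreg : GeodesicRay.endpoint (productRay o (furstenbergProj ξ₁) hθ) ∈ regularBoundary X := by
      have h3 := hθ
      rw [← hs] at h3
      exact h3
    refine ⟨⟨_, hω, hreg⟩,
      Subtype.ext (Prod.ext (funext fun i => ?_) hs)⟩
    exact (congrArg GeodesicRay.endpoint (component_productRay o (furstenbergProj ξ₁) hθ i
      (hreg.1 i))).trans (endpoint_rayFrom _ _)
  have hind : Topology.IsInducing Φ := by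
    refine Topology.IsInducing.of_comp_iff Topology.IsInducing.subtypeVal |>.1 ?_
    refine (isInducing_furstenbergProj_slope o).comp (g := Ψ) (f := j) ?_
    exact Topology.IsInducing.of_comp_iff Topology.IsInducing.subtypeVal |>.1
      Topology.IsInducing.subtypeVal
  exact ⟨(Equiv.ofBijective Φ ⟨hinj, hsurj⟩).toHomeomorphOfIsInducing hind, fun ξ => rfl⟩
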